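/- Let $M$ be a compact (Hausdorff, boundaryless) oriented smooth Riemannian manifold of dimension $n$, and let $H^q_{DR}(M)$ denote its real de Rham cohomology (closed smooth $q$-forms modulo exact ones). Let $J\subseteq\mathbb{R}$ be an interval and let $\{f_t\}_{t\in J}$ be a one-parameter family of smooth maps $f_t:M\to M$ such that $(t,x)\mapsto f_t(x)$ is continuous on $J\times M$ and $f_{t_0}=\mathrm{id}_M$ for some $t_0\in J$ (for instance, a one-parameter group of smooth maps, with $J=\mathbb{R}$ and $t_0=0$). Then every $H^q_{DR}(M)$ is finite-dimensional, so that the Lefschetz number $$\Lambda_f=\sum_{q=0}^{n}(-1)^q\,\mathrm{Tr}\left(f^*\mid H^q_{DR}(M)\right)$$ of a smooth map $f:M\to M$ and the Euler number $$\chi(M)=\sum_{q=0}^{n}(-1)^q\dim H^q_{DR}(M)$$ are well defined, and $$\Lambda_{f_t}=\chi(M)\qquad\text{for every } t\in J .$$ -/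

import Mathlib

open scoped Manifold ContDiff Topology

set_option linter.unusedSectionVars false

noncomputable section

namespace DeRham

/-- The model space `ℝⁿ`. -/
abbrev Euc (n : ℕ) : Type := EuclideanSpace ℝ (Fin n)

section Analysis

variable {n m q : ℕ}

/-- Smoothness of a family of alternating maps can be tested on fixed vectors. -/
theorem contDiffOn_alternating_of_apply {A : Type*} [NormedAddCommGroup A] [NormedSpace ℝ A]
    {w : A → Euc n [⋀^Fin q]→L[ℝ] ℝ} {s : Set A}
    (h : ∀ v : Fin q → Euc n, ContDiffOn ℝ ∞ (fun a => w a v) s) : ContDiffOn ℝ ∞ w s := by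
  let b := Module.finBasis ℝ (Euc n)
  let ev : (Euc n [⋀^Fin q]→L[ℝ] ℝ) →ₗ[ℝ]
      ((Fin q → Fin (Module.finrank ℝ (Euc n))) → ℝ) :=
    { toFun := fun a i => a (fun j => b (i j))
      map_add' := fun _ _ => rfl
      map_smul' := fun _ _ => rfl }
  have hinj : LinearMap.ker ev = ⊥ := by
    rw [LinearMap.ker_eq_bot]
    intro a a' haa
    apply ContinuousAlternatingMap.toAlternatingMap_injective
    apply AlternatingMap.coe_multilinearMap_injective
    exact Module.Basis.ext_multilinear (fun _ => b) (fun i => congrFun haa i)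
  obtain ⟨L, hL⟩ := LinearMap.exists_leftInverse_of_injective ev hinj
  have hw : w = fun a => L.toContinuousLinearMap (ev (w a)) := by
    funext a
    exact (LinearMap.congr_fun hL (w a)).symm
  rw [hw]
  refine L.toContinuousLinearMap.contDiff.comp_contDiffOn ?_
  rw [contDiffOn_pi]
  intro i
  exact h _

theorem contDiffOn_compContinuousLinearMap {A : Type*} [NormedAddCommGroup A] [NormedSpace ℝ A]
    {w : A → Euc m [⋀^Fin q]→L[ℝ] ℝ} {g : A → Euc n →L[ℝ] Euc m} {s : Set A}
    (hw : ContDiffOn ℝ ∞ w s) (hg : ContDiffOn ℝ ∞ g s) :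
    ContDiffOn ℝ ∞ (fun a => (w a).compContinuousLinearMap (g a)) s := by
  apply contDiffOn_alternating_of_apply
  intro v
  have h1 : ContDiffOn ℝ ∞ (fun a =>
      ContinuousMultilinearMap.compContinuousLinearMapContinuousMultilinear ℝ
        (fun _ : Fin q => Euc n) (fun _ => Euc m) ℝ (fun _ => g a)) s :=
    (ContinuousMultilinearMap.contDiff _).comp_contDiffOn (contDiffOn_pi.2 fun _ => hg)
  have h2 : ContDiffOn ℝ ∞ (fun a =>
      ContinuousAlternatingMap.toContinuousMultilinearMapCLM ℝ (w a)) s :=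
    (ContinuousLinearMap.contDiff _).comp_contDiffOn hw
  have h3 := h1.clm_apply h2
  exact (ContinuousMultilinearMap.apply ℝ (fun _ : Fin q => Euc n) ℝ v).contDiff.comp_contDiffOn h3

end Analysis

section Forms

variable (n : ℕ) (M : Type*) [TopologicalSpace M] [ChartedSpace (Euc n) M]

/-- Not necessarily smooth `q`-forms on `M`: an alternating `q`-linear form on every tangent
space. -/
def RoughForm (q : ℕ) : Type _ :=
  (x : M) → (TangentSpace (𝓡 n) x) [⋀^Fin q]→L[ℝ] ℝ

/-- Pointwise addition of forms. -/
instance (q : ℕ) : AddCommGroup (RoughForm n M q) :=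
  inferInstanceAs (AddCommGroup (M → Euc n [⋀^Fin q]→L[ℝ] ℝ))

/-- Pointwise scalar multiplication of forms. -/
instance (q : ℕ) : Module ℝ (RoughForm n M q) :=
  inferInstanceAs (Module ℝ (M → Euc n [⋀^Fin q]→L[ℝ] ℝ))

@[simp] theorem RoughForm.add_apply {q : ℕ} (α β : RoughForm n M q) (x : M) :
    (α + β) x = α x + β x := rfl

@[simp] theorem RoughForm.smul_apply {q : ℕ} (c : ℝ) (α : RoughForm n M q) (x : M) :
    (c • α) x = c • α x := rfl

@[simp] theorem RoughForm.zero_apply {q : ℕ} (x : M) : (0 : RoughForm n M q) x = 0 := rfl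

variable {n M}

/-- The expression of a form in the coordinates given by the chart at `x₀`: its pullback
along the inverse of this chart. It is meaningful on the target of the chart. -/
def coordRep {q : ℕ} (α : RoughForm n M q) (x₀ : M) (y : Euc n) : Euc n [⋀^Fin q]→L[ℝ] ℝ :=
  (α ((extChartAt (𝓡 n) x₀).symm y)).compContinuousLinearMap
    (mfderiv (𝓡 n) (𝓡 n) (extChartAt (𝓡 n) x₀).symm y)

/-- A form is smooth if its expressions in the charts are smooth. -/
def IsSmoothForm {q : ℕ} (α : RoughForm n M q) : Prop :=
  ∀ x₀ : M, ContDiffOn ℝ ∞ (coordRep α x₀) (extChartAt (𝓡 n) x₀).target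

theorem coordRep_add {q : ℕ} (α η : RoughForm n M q) (x₀ : M) :
    coordRep (α + η) x₀ = coordRep α x₀ + coordRep η x₀ := rfl

theorem coordRep_smul {q : ℕ} (c : ℝ) (α : RoughForm n M q) (x₀ : M) :
    coordRep (c • α) x₀ = c • coordRep α x₀ := rfl

variable (n M)

/-- The space `Ω^q(M)` of smooth `q`-forms on `M`. -/
def Form (q : ℕ) : Submodule ℝ (RoughForm n M q) where
  carrier := {α | IsSmoothForm α}
  add_mem' := fun {α η} hα hη x₀ => by
    rw [coordRep_add]; exact (hα x₀).add (hη x₀)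
  zero_mem' := fun x₀ => by
    have : coordRep (0 : RoughForm n M q) x₀ = fun _ => 0 := rfl
    rw [this]; exact contDiffOn_const
  smul_mem' := fun c α hα x₀ => by
    rw [coordRep_smul]; exact (hα x₀).const_smul c

variable {n M}

/-- The pullback `f^*α` of a form along a map. -/
def roughPullback {m : ℕ} {N : Type*} [TopologicalSpace N] [ChartedSpace (Euc m) N] {q : ℕ}
    (f : M → N) (α : RoughForm m N q) : RoughForm n M q :=
  fun x => (α (f x)).compContinuousLinearMap (mfderiv (𝓡 n) (𝓡 m) f x)

/-- The exterior derivative, computed at `x` in the coordinates given by the chart at `x`. -/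
def roughExtDeriv {q : ℕ} (α : RoughForm n M q) : RoughForm n M (q + 1) :=
  fun x => (extDeriv (coordRep α x) (extChartAt (𝓡 n) x x)).compContinuousLinearMap
    (mfderiv (𝓡 n) (𝓡 n) (extChartAt (𝓡 n) x) x)

end Forms

section Naturality

theorem minSmoothness_two_le : minSmoothness ℝ 2 ≤ (∞ : WithTop ℕ∞) := by
  rw [minSmoothness_of_isRCLikeNormedField]
  exact WithTop.coe_le_coe.2 (le_top : (2 : ℕ∞) ≤ ⊤)

variable {n m q : ℕ} {M : Type*} [TopologicalSpace M] [ChartedSpace (Euc n) M]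
  [IsManifold (𝓡 n) ∞ M]
  {N : Type*} [TopologicalSpace N] [ChartedSpace (Euc m) N] [IsManifold (𝓡 m) ∞ N]

/-- The expression of `f` in the charts at `x₀` and `z₀`. -/
def coordMap (f : M → N) (x₀ : M) (z₀ : N) : Euc n → Euc m :=
  fun y => extChartAt (𝓡 m) z₀ (f ((extChartAt (𝓡 n) x₀).symm y))

theorem contMDiffAt_symm {x₀ : M} {y : Euc n} (hy : y ∈ (extChartAt (𝓡 n) x₀).target) :
    ContMDiffAt (𝓡 n) (𝓡 n) ∞ (extChartAt (𝓡 n) x₀).symm y :=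
  (contMDiffOn_extChartAt_symm x₀).contMDiffAt ((isOpen_extChartAt_target x₀).mem_nhds hy)

theorem contMDiffAt_chart {x₀ x : M} (hx : x ∈ (extChartAt (𝓡 n) x₀).source) :
    ContMDiffAt (𝓡 n) (𝓡 n) ∞ (extChartAt (𝓡 n) x₀) x :=
  contMDiffAt_extChartAt' (by rwa [extChartAt_source] at hx)

theorem contDiffAt_coordMap {f : M → N} (hf : ContMDiff (𝓡 n) (𝓡 m) ∞ f) {x₀ : M} {z₀ : N}
    {y : Euc n} (hy : y ∈ (extChartAt (𝓡 n) x₀).target)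
    (hz : f ((extChartAt (𝓡 n) x₀).symm y) ∈ (extChartAt (𝓡 m) z₀).source) :
    ContDiffAt ℝ ∞ (coordMap (n := n) (m := m) f x₀ z₀) y := by
  rw [← contMDiffAt_iff_contDiffAt]
  have h1 : ContMDiffAt (𝓡 n) (𝓡 m) ∞ (f ∘ (extChartAt (𝓡 n) x₀).symm) y :=
    ContMDiffAt.comp y hf.contMDiffAt (contMDiffAt_symm hy)
  exact ContMDiffAt.comp (g := extChartAt (𝓡 m) z₀) (f := f ∘ (extChartAt (𝓡 n) x₀).symm) y
    (contMDiffAt_chart hz) h1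

theorem eventually_coord {f : M → N} (hf : Continuous f) {x₀ : M} {z₀ : N}
    {y : Euc n} (hy : y ∈ (extChartAt (𝓡 n) x₀).target)
    (hz : f ((extChartAt (𝓡 n) x₀).symm y) ∈ (extChartAt (𝓡 m) z₀).source) :
    ∀ᶠ y' in 𝓝 y, y' ∈ (extChartAt (𝓡 n) x₀).target ∧
      f ((extChartAt (𝓡 n) x₀).symm y') ∈ (extChartAt (𝓡 m) z₀).source := by
  refine ((isOpen_extChartAt_target x₀).mem_nhds hy |> Filter.Eventually.and) ?_
  have h1 : ContinuousAt (fun y' => f ((extChartAt (𝓡 n) x₀).symm y')) y :=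
    hf.continuousAt.comp (contMDiffAt_symm hy).continuousAt
  exact h1 ((isOpen_extChartAt_source z₀).mem_nhds hz)

/-- The pullback in coordinates. -/
theorem coordRep_roughPullback {f : M → N} (hf : ContMDiff (𝓡 n) (𝓡 m) ∞ f)
    (α : RoughForm m N q) {x₀ : M} {z₀ : N}
    {y : Euc n} (hy : y ∈ (extChartAt (𝓡 n) x₀).target)
    (hz : f ((extChartAt (𝓡 n) x₀).symm y) ∈ (extChartAt (𝓡 m) z₀).source) :
    coordRep (roughPullback f α) x₀ y =
      (coordRep α z₀ (coordMap f x₀ z₀ y)).compContinuousLinearMap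
        (fderiv ℝ (coordMap f x₀ z₀) y) := by
  let w : N → Euc m [⋀^Fin q]→L[ℝ] ℝ := α
  have hF := contDiffAt_coordMap hf hy hz
  have hFt : coordMap f x₀ z₀ y ∈ (extChartAt (𝓡 m) z₀).target :=
    (extChartAt (𝓡 m) z₀).map_source hz
  have hback : (extChartAt (𝓡 m) z₀).symm (coordMap f x₀ z₀ y) =
      f ((extChartAt (𝓡 n) x₀).symm y) := (extChartAt (𝓡 m) z₀).left_inv hz
  have d1 : HasMFDerivAt (𝓡 n) (𝓡 m) (f ∘ (extChartAt (𝓡 n) x₀).symm) y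
      ((mfderiv (𝓡 n) (𝓡 m) f ((extChartAt (𝓡 n) x₀).symm y)).comp
        (mfderiv (𝓡 n) (𝓡 n) (extChartAt (𝓡 n) x₀).symm y)) :=
    HasMFDerivAt.comp y (hf.mdifferentiable (by simp) _).hasMFDerivAt
      ((contMDiffAt_symm hy).mdifferentiableAt (by simp)).hasMFDerivAt
  have d2 : HasMFDerivAt (𝓡 n) (𝓡 m) ((extChartAt (𝓡 m) z₀).symm ∘ coordMap f x₀ z₀) y
      ((mfderiv (𝓡 m) (𝓡 m) (extChartAt (𝓡 m) z₀).symm (coordMap f x₀ z₀ y)).comp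
        (fderiv ℝ (coordMap f x₀ z₀) y)) :=
    HasMFDerivAt.comp y ((contMDiffAt_symm hFt).mdifferentiableAt (by simp)).hasMFDerivAt
      (hF.differentiableAt (by simp)).hasFDerivAt.hasMFDerivAt
  have heq : (extChartAt (𝓡 m) z₀).symm ∘ coordMap f x₀ z₀ =ᶠ[𝓝 y]
      f ∘ (extChartAt (𝓡 n) x₀).symm := by
    filter_upwards [eventually_coord hf.continuous hy hz] with y' hy'
    exact (extChartAt (𝓡 m) z₀).left_inv hy'.2
  have d3 := d1.congr_of_eventuallyEq heq
  have key := hasMFDerivAt_unique d2 d3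
  let A : Euc n →L[ℝ] Euc m :=
    (mfderiv (𝓡 n) (𝓡 m) f ((extChartAt (𝓡 n) x₀).symm y)).comp
        (mfderiv (𝓡 n) (𝓡 n) (extChartAt (𝓡 n) x₀).symm y)
  let B : Euc n →L[ℝ] Euc m :=
    (mfderiv (𝓡 m) (𝓡 m) (extChartAt (𝓡 m) z₀).symm (coordMap f x₀ z₀ y)).comp
        (fderiv ℝ (coordMap f x₀ z₀) y)
  have hBA : B = A := key
  change (w (f ((extChartAt (𝓡 n) x₀).symm y))).compContinuousLinearMap A =
    (w ((extChartAt (𝓡 m) z₀).symm (coordMap f x₀ z₀ y))).compContinuousLinearMap B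
  rw [hBA, hback]

theorem roughPullback_id (α : RoughForm n M q) : roughPullback (n := n) (id : M → M) α = α := by
  funext x
  change (α x).compContinuousLinearMap (mfderiv (𝓡 n) (𝓡 n) id x) = α x
  rw [mfderiv_id]
  rfl

theorem IsSmoothForm.contDiffAt {α : RoughForm n M q} (hα : IsSmoothForm α) {x₀ : M} {y : Euc n}
    (hy : y ∈ (extChartAt (𝓡 n) x₀).target) : ContDiffAt ℝ ∞ (coordRep α x₀) y :=
  (hα x₀).contDiffAt ((isOpen_extChartAt_target x₀).mem_nhds hy)

/-- The pullback of a smooth form along a smooth map is smooth. -/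
theorem IsSmoothForm.roughPullback {α : RoughForm m N q} (hα : IsSmoothForm α) {f : M → N}
    (hf : ContMDiff (𝓡 n) (𝓡 m) ∞ f) :
    IsSmoothForm (DeRham.roughPullback (n := n) f α) := by
  intro x₀ y hy
  set z₀ := f ((extChartAt (𝓡 n) x₀).symm y) with hz₀
  have hz : f ((extChartAt (𝓡 n) x₀).symm y) ∈ (extChartAt (𝓡 m) z₀).source :=
    mem_extChartAt_source z₀
  obtain ⟨U, hU, hUo, hyU⟩ := eventually_nhds_iff.1 (eventually_coord hf.continuous hy hz)
  have hF : ContDiffOn ℝ ∞ (coordMap f x₀ z₀) U := fun y' hy' =>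
    (contDiffAt_coordMap hf (hU y' hy').1 (hU y' hy').2).contDiffWithinAt
  have h1 : ContDiffOn ℝ ∞ (fun y' => coordRep α z₀ (coordMap f x₀ z₀ y')) U :=
    (hα z₀).comp hF fun y' hy' => (extChartAt (𝓡 m) z₀).map_source (hU y' hy').2
  have h2 : ContDiffOn ℝ ∞ (fderiv ℝ (coordMap f x₀ z₀)) U :=
    hF.fderiv_of_isOpen hUo (by simp)
  have h3 := contDiffOn_compContinuousLinearMap h1 h2
  have h4 : ContDiffOn ℝ ∞ (coordRep (DeRham.roughPullback (n := n) f α) x₀) U :=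
    h3.congr fun y' hy' => coordRep_roughPullback hf α (hU y' hy').1 (hU y' hy').2
  exact (h4.contDiffAt (hUo.mem_nhds hyU)).contDiffWithinAt

/-- Exterior derivative of a pullback in coordinates. -/
theorem extDeriv_coordRep_roughPullback {f : M → N} (hf : ContMDiff (𝓡 n) (𝓡 m) ∞ f)
    {α : RoughForm m N q} (hα : IsSmoothForm α) {x₀ : M} {z₀ : N}
    {y : Euc n} (hy : y ∈ (extChartAt (𝓡 n) x₀).target)
    (hz : f ((extChartAt (𝓡 n) x₀).symm y) ∈ (extChartAt (𝓡 m) z₀).source) :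
    extDeriv (coordRep (roughPullback f α) x₀) y =
      (extDeriv (coordRep α z₀) (coordMap f x₀ z₀ y)).compContinuousLinearMap
        (fderiv ℝ (coordMap f x₀ z₀) y) := by
  have heq : coordRep (roughPullback f α) x₀ =ᶠ[𝓝 y] fun y' =>
      (coordRep α z₀ (coordMap f x₀ z₀ y')).compContinuousLinearMap
        (fderiv ℝ (coordMap f x₀ z₀) y') := by
    filter_upwards [eventually_coord hf.continuous hy hz] with y' hy'
    exact coordRep_roughPullback hf α hy'.1 hy'.2
  rw [heq.extDeriv_eq]
  exact extDeriv_pullback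
    ((hα.contDiffAt ((extChartAt (𝓡 m) z₀).map_source hz)).differentiableAt (by simp))
    (contDiffAt_coordMap hf hy hz) minSmoothness_two_le

/-- The exterior derivative is given by the usual formula in every chart. -/
theorem coordRep_roughExtDeriv {α : RoughForm n M q} (hα : IsSmoothForm α) {x₀ : M} {y : Euc n}
    (hy : y ∈ (extChartAt (𝓡 n) x₀).target) :
    coordRep (roughExtDeriv α) x₀ y = extDeriv (coordRep α x₀) y := by
  set x := (extChartAt (𝓡 n) x₀).symm y with hx
  have hz : id ((extChartAt (𝓡 n) x₀).symm y) ∈ (extChartAt (𝓡 n) x).source :=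
    mem_extChartAt_source x
  have h := extDeriv_coordRep_roughPullback (n := n) (M := M) contMDiff_id hα hy hz
  rw [roughPullback_id] at h
  rw [h]
  have d : HasMFDerivAt (𝓡 n) (𝓡 n) (coordMap (id : M → M) x₀ x) y
      ((mfderiv (𝓡 n) (𝓡 n) (extChartAt (𝓡 n) x) x).comp
        (mfderiv (𝓡 n) (𝓡 n) (extChartAt (𝓡 n) x₀).symm y)) :=
    HasMFDerivAt.comp (g := extChartAt (𝓡 n) x) y
      ((contMDiffAt_chart (mem_extChartAt_source x)).mdifferentiableAt (by simp)).hasMFDerivAt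
      ((contMDiffAt_symm hy).mdifferentiableAt (by simp)).hasMFDerivAt
  have key := d.mfderiv
  rw [mfderiv_eq_fderiv] at key
  rw [key]
  rfl

/-- The exterior derivative of a smooth form is smooth. -/
theorem IsSmoothForm.roughExtDeriv {α : RoughForm n M q} (hα : IsSmoothForm α) :
    IsSmoothForm (DeRham.roughExtDeriv α) := by
  intro x₀
  have h1 : ContDiffOn ℝ ∞ (fderiv ℝ (coordRep α x₀)) (extChartAt (𝓡 n) x₀).target :=
    (hα x₀).fderiv_of_isOpen (isOpen_extChartAt_target x₀) (by simp)
  have h2 : ContDiffOn ℝ ∞ (extDeriv (coordRep α x₀)) (extChartAt (𝓡 n) x₀).target :=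
    ContDiff.comp_contDiffOn
      (g := ContinuousAlternatingMap.alternatizeUncurryFinCLM ℝ (Euc n) ℝ (n := q))
      (ContinuousLinearMap.contDiff _) h1
  exact h2.congr fun y hy => coordRep_roughExtDeriv hα hy

/-- The exterior derivative commutes with pullbacks. -/
theorem roughExtDeriv_roughPullback {f : M → N} (hf : ContMDiff (𝓡 n) (𝓡 m) ∞ f)
    {α : RoughForm m N q} (hα : IsSmoothForm α) :
    roughExtDeriv (roughPullback (n := n) f α) = roughPullback f (roughExtDeriv α) := by
  funext x
  have hy : extChartAt (𝓡 n) x x ∈ (extChartAt (𝓡 n) x).target := mem_extChartAt_target x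
  have hxx : (extChartAt (𝓡 n) x).symm (extChartAt (𝓡 n) x x) = x := extChartAt_to_inv x
  have hz : f ((extChartAt (𝓡 n) x).symm (extChartAt (𝓡 n) x x)) ∈
      (extChartAt (𝓡 m) (f x)).source := by
    rw [hxx]; exact mem_extChartAt_source (f x)
  have h := extDeriv_coordRep_roughPullback hf hα hy hz
  have hc : coordMap f x (f x) (extChartAt (𝓡 n) x x) = extChartAt (𝓡 m) (f x) (f x) := by
    simp only [coordMap, hxx]
  have d1 : HasMFDerivAt (𝓡 n) (𝓡 m) (coordMap f x (f x) ∘ extChartAt (𝓡 n) x) x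
      ((fderiv ℝ (coordMap f x (f x)) (extChartAt (𝓡 n) x x)).comp
        (mfderiv (𝓡 n) (𝓡 n) (extChartAt (𝓡 n) x) x)) :=
    HasMFDerivAt.comp x
      ((contDiffAt_coordMap hf hy hz).differentiableAt (by simp)).hasFDerivAt.hasMFDerivAt
      ((contMDiffAt_chart (mem_extChartAt_source x)).mdifferentiableAt (by simp)).hasMFDerivAt
  have d2 : HasMFDerivAt (𝓡 n) (𝓡 m) (extChartAt (𝓡 m) (f x) ∘ f) x
      ((mfderiv (𝓡 m) (𝓡 m) (extChartAt (𝓡 m) (f x)) (f x)).comp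
        (mfderiv (𝓡 n) (𝓡 m) f x)) :=
    HasMFDerivAt.comp x
      ((contMDiffAt_chart (mem_extChartAt_source (f x))).mdifferentiableAt (by simp)).hasMFDerivAt
      (hf.mdifferentiable (by simp) _).hasMFDerivAt
  have heq : coordMap f x (f x) ∘ extChartAt (𝓡 n) x =ᶠ[𝓝 x] extChartAt (𝓡 m) (f x) ∘ f := by
    filter_upwards [extChartAt_source_mem_nhds (I := 𝓡 n) x] with x' hx'
    simp only [coordMap, Function.comp, (extChartAt (𝓡 n) x).left_inv hx']
  have key := hasMFDerivAt_unique d1 (d2.congr_of_eventuallyEq heq)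
  let A : Euc n →L[ℝ] Euc m :=
    (fderiv ℝ (coordMap f x (f x)) (extChartAt (𝓡 n) x x)).comp
        (mfderiv (𝓡 n) (𝓡 n) (extChartAt (𝓡 n) x) x)
  let B : Euc n →L[ℝ] Euc m :=
    (mfderiv (𝓡 m) (𝓡 m) (extChartAt (𝓡 m) (f x)) (f x)).comp
        (mfderiv (𝓡 n) (𝓡 m) f x)
  have hAB : A = B := key
  unfold roughExtDeriv
  rw [h, hc]
  change (extDeriv (coordRep α (f x)) (extChartAt (𝓡 m) (f x) (f x))).compContinuousLinearMap A =
    (extDeriv (coordRep α (f x)) (extChartAt (𝓡 m) (f x) (f x))).compContinuousLinearMap B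
  rw [hAB]

end Naturality

section Cohomology

variable (n : ℕ) (M : Type*) [TopologicalSpace M] [ChartedSpace (Euc n) M]
  [IsManifold (𝓡 n) ∞ M]


/-- The exterior derivative `d : Ω^q(M) → Ω^{q+1}(M)`. -/
def d (q : ℕ) : Form n M q →ₗ[ℝ] Form n M (q + 1) where
  toFun α := ⟨roughExtDeriv α.1, IsSmoothForm.roughExtDeriv α.2⟩
  map_add' α η := by
    apply Subtype.ext
    funext x
    have hα := (IsSmoothForm.contDiffAt α.2 (mem_extChartAt_target (I := 𝓡 n) x)).differentiableAt
      (by simp)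
    have hη := (IsSmoothForm.contDiffAt η.2 (mem_extChartAt_target (I := 𝓡 n) x)).differentiableAt
      (by simp)
    change (extDeriv (coordRep α.1 x + coordRep η.1 x) _).compContinuousLinearMap _ = _
    rw [extDeriv_add hα hη]
    rfl
  map_smul' c α := by
    apply Subtype.ext
    funext x
    change (extDeriv (c • coordRep α.1 x) _).compContinuousLinearMap _ = _
    rw [extDeriv_smul]
    rfl

/-- The exact `q`-forms: the image of `d : Ω^{q-1}(M) → Ω^q(M)`, which is `0` for `q = 0`. -/
def exactForms : (q : ℕ) → Submodule ℝ (Form n M q)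
  | 0 => ⊥
  | q + 1 => LinearMap.range (d n M q)

/-- The closed `q`-forms: the kernel of `d : Ω^q(M) → Ω^{q+1}(M)`. -/
def closedForms (q : ℕ) : Submodule ℝ (Form n M q) := LinearMap.ker (d n M q)

/-- The de Rham cohomology `H^q(M)`: closed `q`-forms modulo exact `q`-forms. -/
abbrev Cohomology (q : ℕ) : Type _ :=
  (closedForms n M q) ⧸ (exactForms n M q).submoduleOf (closedForms n M q)

/-- Every exact form is closed. -/
theorem exactForms_le_closedForms (q : ℕ) : exactForms n M q ≤ closedForms n M q := by
  cases q with
  | zero => exact bot_le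
  | succ q =>
    rintro _ ⟨α, rfl⟩
    apply Subtype.ext
    funext x
    have hx := mem_extChartAt_target (I := 𝓡 n) x
    have heq : coordRep (roughExtDeriv α.1) x =ᶠ[𝓝 (extChartAt (𝓡 n) x x)]
        extDeriv (coordRep α.1 x) := by
      filter_upwards [(isOpen_extChartAt_target (I := 𝓡 n) x).mem_nhds hx] with y hy
      exact coordRep_roughExtDeriv α.2 hy
    change (extDeriv (coordRep (roughExtDeriv α.1) x) _).compContinuousLinearMap _ = 0
    rw [heq.extDeriv_eq, extDeriv_extDeriv_apply (IsSmoothForm.contDiffAt α.2 hx) minSmoothness_two_le]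
    rfl

variable {n M} {m : ℕ} {N : Type*} [TopologicalSpace N] [ChartedSpace (Euc m) N]
  [IsManifold (𝓡 m) ∞ N]

/-- The pullback `f^* : Ω^q(N) → Ω^q(M)` along a smooth map `f : M → N`. -/
def pullback (f : C^∞⟮𝓡 n, M; 𝓡 m, N⟯) (q : ℕ) : Form m N q →ₗ[ℝ] Form n M q where
  toFun α := ⟨roughPullback f α.1, IsSmoothForm.roughPullback α.2 f.contMDiff⟩
  map_add' _ _ := rfl
  map_smul' _ _ := rfl

theorem d_pullback (f : C^∞⟮𝓡 n, M; 𝓡 m, N⟯) (q : ℕ) (α : Form m N q) :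
    d n M q (pullback f q α) = pullback f (q + 1) (d m N q α) :=
  Subtype.ext (roughExtDeriv_roughPullback f.contMDiff α.2)

/-- The pullback on closed forms. -/
def closedPullback (f : C^∞⟮𝓡 n, M; 𝓡 m, N⟯) (q : ℕ) :
    closedForms m N q →ₗ[ℝ] closedForms n M q :=
  (pullback f q).restrict fun α hα => by
    change d n M q (pullback f q α) = 0
    rw [d_pullback, show d m N q α = 0 from hα, map_zero]

/-- The map `f^* : H^q(N) → H^q(M)`, `f^*[α] = [f^*α]`, induced by a smooth map `f : M → N`. -/
def cohomologyMap (f : C^∞⟮𝓡 n, M; 𝓡 m, N⟯) (q : ℕ) :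
    Cohomology m N q →ₗ[ℝ] Cohomology n M q :=
  Submodule.mapQ _ _ (closedPullback f q) <| by
    intro α hα
    change pullback f q α.1 ∈ exactForms n M q
    have hα' : α.1 ∈ exactForms m N q := hα
    cases q with
    | zero =>
      have h0 : α.1 = 0 := hα'
      rw [h0, map_zero]
      exact Submodule.zero_mem _
    | succ q =>
      obtain ⟨η, hη⟩ := hα'
      exact ⟨pullback f q η, by rw [d_pullback, hη]⟩

/-- The Lefschetz number `Λ_f = ∑_q (-1)^q Tr(f^* | H^q(M))` of a smooth self-map of an
`n`-dimensional manifold; there are no nonzero forms in degree `q > n`. -/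
def lefschetzNumber (f : C^∞⟮𝓡 n, M; 𝓡 n, M⟯) : ℝ :=
  ∑ q ∈ Finset.range (n + 1), (-1 : ℝ) ^ q * LinearMap.trace ℝ (Cohomology n M q) (cohomologyMap f q)

variable (n M)

/-- The `q`-th Betti number `b_q(M) = dim H^q(M)`. -/
def bettiNumber (q : ℕ) : ℕ := Module.finrank ℝ (Cohomology n M q)

/-- The Euler number `χ(M) = ∑_q (-1)^q b_q(M)` of an `n`-dimensional manifold. -/
def eulerNumber : ℤ :=
  ∑ q ∈ Finset.range (n + 1), (-1 : ℤ) ^ q * (bettiNumber n M q : ℤ)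

end Cohomology

section Structures

variable (n : ℕ) (M : Type*) [TopologicalSpace M] [ChartedSpace (Euc n) M]
  [IsManifold (𝓡 n) ∞ M]

/-- A smooth Riemannian metric on `M`. -/
abbrev RiemannianMetric : Type _ :=
  Bundle.ContMDiffRiemannianMetric (𝓡 n) ∞ (Euc n) (fun x : M => TangentSpace (𝓡 n) x)

/-- A volume form on `M`: a smooth nowhere vanishing `n`-form. It defines an orientation. -/
structure VolumeForm where
  /-- The underlying smooth `n`-form. -/
  form : Form n M n
  ne_zero : ∀ x : M, form.1 x ≠ 0

end Structures

end DeRham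

end

/-!
The proof has two ingredients: `M` is a smooth retract of an open subset of a Euclidean space, and
on open subsets of Euclidean spaces differential forms are plain functions, for which the needed
parts of de Rham theory are elementary.

Embed `M` into `ℝᴺ` by a map `e`. The nearest-point map `r` is smooth on an open neighbourhood `U`
of `e(M)`: nearest points are critical points of the distance, and by the inverse function theorem
these depend smoothly on the given point (`exists_smooth_criticalPoint`,
`exists_smooth_retraction`). Since `r ∘ e = id`, every form on `M` is `e^*` of the form `r^*α`
on `U`.

Finite-dimensionality (`finiteDimensional_cohomology`): `e(M)` has a neighbourhood `V ⊆ U` that is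
a finite union of balls. Intersections of convex sets are convex, so by induction with the Poincaré
lemma (`hasFiniteCohomology_of_convex`) and a Mayer–Vietoris argument
(`HasFiniteCohomology.sup`) the cohomology of `V` is finite-dimensional; and `r^*` embeds the
cohomology of `M` into that of `V`. No quotients are formed on the Euclidean side: a subspace `Z`
of forms is called finite modulo `B` if `Z ≤ F + B` with `F` finitely generated (`FinMod`).

Homotopy invariance (`cohomologyMap_eq_of_continuous`): if `f` and `g` are uniformly close
self-maps of `M`, then the extensions `e ∘ f ∘ r` and `e ∘ g ∘ r` are joined within `U` by a
straight-line homotopy, which is smooth although the given family is only continuous in `t`. The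
fibre integral over this homotopy (`extDeriv_integral_contractTime`) shows that the pullbacks of a
closed form differ by an exact one (`eucPullback_sub_mem_exactOn`), so `f` and `g` agree on
cohomology. Hence `t ↦ f_t^*` is locally constant on the connected set `J`, and it is the identity
at `t₀`. The trace of the identity of `H^q` is the `q`-th Betti number, so that the Lefschetz number
is the Euler number.
-/

namespace DeRham

open Set Filter MeasureTheory

/-! ### Smooth parametric integrals -/

section ParametricIntegral

variable {E F : Type} [NormedAddCommGroup E] [NormedSpace ℝ E] [ProperSpace E]
  [NormedAddCommGroup F] [NormedSpace ℝ F] {W : Set (ℝ × E)} {O : Set E}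

theorem hasFDerivAt_integral_unitInterval {g : ℝ × E → F} (hg : ContDiffOn ℝ ∞ g W)
    (hW : IsOpen W) (hO : IsOpen O) (hWO : Icc (0 : ℝ) 1 ×ˢ O ⊆ W) {y : E} (hy : y ∈ O) :
    HasFDerivAt (fun y => ∫ s in (0 : ℝ)..1, g (s, y))
      (∫ s in (0 : ℝ)..1, (fderiv ℝ g (s, y)).comp (ContinuousLinearMap.inr ℝ ℝ E)) y := by
  obtain ⟨ε, hε, hεO⟩ := Metric.nhds_basis_closedBall.mem_iff.1 (hO.mem_nhds hy)
  have hcomp : IsCompact (Icc (0 : ℝ) 1 ×ˢ Metric.closedBall y ε) :=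
    isCompact_Icc.prod (isCompact_closedBall y ε)
  have hsub : Icc (0 : ℝ) 1 ×ˢ Metric.closedBall y ε ⊆ W :=
    (prod_mono_right hεO).trans hWO
  have hD : ContinuousOn (fun p => (fderiv ℝ g p).comp (ContinuousLinearMap.inr ℝ ℝ E)) W :=
    (hg.continuousOn_fderiv_of_isOpen hW (by simp)).clm_comp continuousOn_const
  obtain ⟨C, hC⟩ := hcomp.exists_bound_of_continuousOn (hD.mono hsub)
  have hline : ∀ z : E, Continuous fun s : ℝ => (s, z) := fun z => by fun_prop
  have hIoc : ∀ s : ℝ, s ∈ uIoc (0 : ℝ) 1 → s ∈ Icc (0 : ℝ) 1 := fun s hs => by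
    rw [uIoc_of_le zero_le_one] at hs
    exact Ioc_subset_Icc_self hs
  have hcont : ∀ z ∈ O, ContinuousOn (fun s : ℝ => g (s, z)) (uIcc 0 1) := fun z hz =>
    hg.continuousOn.comp (hline z).continuousOn fun s hs => by
      rw [uIcc_of_le zero_le_one] at hs
      exact hWO ⟨hs, hz⟩
  have hDcont : ContinuousOn
      (fun s : ℝ => (fderiv ℝ g (s, y)).comp (ContinuousLinearMap.inr ℝ ℝ E)) (uIcc 0 1) :=
    hD.comp (hline y).continuousOn fun s hs => by
      rw [uIcc_of_le zero_le_one] at hs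
      exact hWO ⟨hs, hy⟩
  refine intervalIntegral.hasFDerivAt_integral_of_dominated_of_fderiv_le (𝕜 := ℝ)
    (F := fun z s => g (s, z)) (bound := fun _ => C)
    (F' := fun z s => (fderiv ℝ g (s, z)).comp (ContinuousLinearMap.inr ℝ ℝ E))
    (Metric.closedBall_mem_nhds y hε) ?_ ?_ ?_ ?_ ?_ ?_
  · filter_upwards [hO.mem_nhds hy] with z hz
    exact (hcont z hz).intervalIntegrable.aestronglyMeasurable_restrict_uIoc
  · exact (hcont y hy).intervalIntegrable
  · exact hDcont.intervalIntegrable.aestronglyMeasurable_restrict_uIoc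
  · exact Eventually.of_forall fun s hs z hz => hC (s, z) ⟨hIoc s hs, hz⟩
  · exact intervalIntegrable_const
  · refine Eventually.of_forall fun s hs z hz => ?_
    have h1 : HasFDerivAt g (fderiv ℝ g (s, z)) (s, z) :=
      ((hg.contDiffAt (hW.mem_nhds (hsub ⟨hIoc s hs, hz⟩))).differentiableAt
        (by simp)).hasFDerivAt
    exact h1.comp z (hasFDerivAt_prodMk_right s z)

theorem contDiffOn_integral_unitInterval {g : ℝ × E → F} (hg : ContDiffOn ℝ ∞ g W)
    (hW : IsOpen W) (hO : IsOpen O) (hWO : Icc (0 : ℝ) 1 ×ˢ O ⊆ W) :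
    ContDiffOn ℝ ∞ (fun y => ∫ s in (0 : ℝ)..1, g (s, y)) O := by
  refine contDiffOn_infty.2 fun k => ?_
  induction k generalizing F with
  | zero =>
    refine contDiffOn_zero.2 fun y hy => ?_
    exact (hasFDerivAt_integral_unitInterval hg hW hO hWO hy).continuousAt.continuousWithinAt
  | succ k ih =>
    refine (contDiffOn_succ_iff_fderiv_of_isOpen (n := k) hO).2 ⟨fun y hy =>
      (hasFDerivAt_integral_unitInterval hg hW hO hWO hy).differentiableAt.differentiableWithinAt,
      by simp, ?_⟩
    have hD : ContDiffOn ℝ ∞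
        (fun p => (fderiv ℝ g p).comp (ContinuousLinearMap.inr ℝ ℝ E)) W :=
      (hg.fderiv_of_isOpen hW (by simp)).clm_comp contDiffOn_const
    exact (ih hD).congr fun y hy => (hasFDerivAt_integral_unitInterval hg hW hO hWO hy).fderiv

end ParametricIntegral

/-! ### The homotopy formula for forms on open subsets of Euclidean space -/

section Homotopy

variable {N q : ℕ}

/-- Contraction of an alternating form on `ℝ × E` with the unit vector `∂/∂s` of the first factor,
restricted to `E`. -/
noncomputable def contractTime (E : Type) [NormedAddCommGroup E] [NormedSpace ℝ E] (q : ℕ) :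
    ((ℝ × E) [⋀^Fin (q + 1)]→L[ℝ] ℝ) →L[ℝ] (E [⋀^Fin q]→L[ℝ] ℝ) :=
  (ContinuousAlternatingMap.compContinuousLinearMapCLM (ContinuousLinearMap.inr ℝ ℝ E)).comp
    ((ContinuousLinearMap.apply ℝ ((ℝ × E) [⋀^Fin q]→L[ℝ] ℝ) ((1, 0) : ℝ × E)).comp
      (ContinuousAlternatingMap.curryLeftLI
        (𝕜 := ℝ) (E := ℝ × E) (F := ℝ) (n := q)).toContinuousLinearMap)

/-- Cartan's formula at a point: if the form is closed, then the derivative along `∂/∂s` is the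
exterior derivative of the contraction with `∂/∂s`. -/
theorem alternatizeUncurryFin_contractTime {E : Type} [NormedAddCommGroup E] [NormedSpace ℝ E]
    (D : (ℝ × E) →L[ℝ] ((ℝ × E) [⋀^Fin (q + 1)]→L[ℝ] ℝ))
    (hD : ContinuousAlternatingMap.alternatizeUncurryFin D = 0) (v : Fin (q + 1) → E) :
    ContinuousAlternatingMap.alternatizeUncurryFin
      ((contractTime E q).comp (D.comp (ContinuousLinearMap.inr ℝ ℝ E))) v =
      D (1, 0) fun i => (0, v i) := by
  have h := DFunLike.congr_fun hD (Fin.cons ((1, 0) : ℝ × E) fun i => ((0, v i) : ℝ × E))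
  rw [ContinuousAlternatingMap.alternatizeUncurryFin_apply, Fin.sum_univ_succ] at h
  rw [ContinuousAlternatingMap.alternatizeUncurryFin_apply]
  have h0 : Fin.removeNth (α := fun _ => ℝ × E) 0 (Fin.cons ((1, 0) : ℝ × E) fun i => ((0, v i) : ℝ × E)) =
      fun i => ((0, v i) : ℝ × E) := by
    funext i; simp [Fin.removeNth]
  have hs : ∀ i : Fin (q + 1),
      Fin.removeNth (α := fun _ => ℝ × E) i.succ (Fin.cons ((1, 0) : ℝ × E) fun i => ((0, v i) : ℝ × E)) =
      Fin.cons ((1, 0) : ℝ × E) fun j => (0, Fin.removeNth i v j) := by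
    intro i; funext j
    refine Fin.cases ?_ (fun j => ?_) j
    · simp [Fin.removeNth]
    · simp [Fin.removeNth, Fin.succ_succAbove_succ]
  simp only [h0, hs, Fin.cons_zero, Fin.cons_succ, Fin.val_zero, pow_zero, one_smul, Fin.val_succ,
    pow_succ, ContinuousAlternatingMap.coe_zero, Pi.zero_apply] at h
  simp only [mul_neg, mul_one, neg_smul, Finset.sum_neg_distrib, add_neg_eq_zero] at h
  rw [h]
  rfl

set_option maxSynthPendingDepth 5 in
/-- For a closed form `w` of positive degree near `[0, 1] × O`, the fibre integral of
`ι_{∂/∂s} w` is a primitive of the difference of the restrictions of `w` to the two ends. -/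
theorem extDeriv_integral_contractTime {W : Set (ℝ × Euc N)} {O : Set (Euc N)}
    {w : ℝ × Euc N → (ℝ × Euc N) [⋀^Fin (q + 1)]→L[ℝ] ℝ} (hw : ContDiffOn ℝ ∞ w W)
    (hW : IsOpen W) (hO : IsOpen O) (hWO : Icc (0 : ℝ) 1 ×ˢ O ⊆ W)
    (hd : ∀ p ∈ W, extDeriv w p = 0) {y : Euc N} (hy : y ∈ O) :
    extDeriv (fun y => ∫ s in (0 : ℝ)..1, contractTime (Euc N) q (w (s, y))) y =
      (w (1, y)).compContinuousLinearMap (ContinuousLinearMap.inr ℝ ℝ (Euc N)) -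
        (w (0, y)).compContinuousLinearMap (ContinuousLinearMap.inr ℝ ℝ (Euc N)) := by
  have hmem : ∀ s ∈ uIcc (0 : ℝ) 1, (s, y) ∈ W := fun s hs => by
    rw [uIcc_of_le zero_le_one] at hs
    exact hWO ⟨hs, hy⟩
  have hwd : ∀ s ∈ uIcc (0 : ℝ) 1, HasFDerivAt w (fderiv ℝ w (s, y)) (s, y) := fun s hs =>
    ((hw.contDiffAt (hW.mem_nhds (hmem s hs))).differentiableAt (by simp)).hasFDerivAt
  have hg : ContDiffOn ℝ ∞ (fun p => contractTime (Euc N) q (w p)) W :=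
    (contractTime (Euc N) q).contDiff.comp_contDiffOn hw
  have hDw : ContinuousOn (fderiv ℝ w) W := hw.continuousOn_fderiv_of_isOpen hW (by simp)
  have hline : ContinuousOn (fun s : ℝ => (s, y)) (uIcc 0 1) := by fun_prop
  have hgd : ∀ s ∈ uIcc (0 : ℝ) 1, fderiv ℝ (fun p => contractTime (Euc N) q (w p)) (s, y) =
      (contractTime (Euc N) q).comp (fderiv ℝ w (s, y)) := fun s hs =>
    ((contractTime (Euc N) q).hasFDerivAt.comp (s, y) (hwd s hs)).fderiv
  have hK := (hasFDerivAt_integral_unitInterval hg hW hO hWO hy).fderiv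
  have hcongr : (∫ s in (0 : ℝ)..1, (fderiv ℝ (fun p => contractTime (Euc N) q (w p)) (s, y)).comp
        (ContinuousLinearMap.inr ℝ ℝ (Euc N))) =
      ∫ s in (0 : ℝ)..1, (contractTime (Euc N) q).comp ((fderiv ℝ w (s, y)).comp
        (ContinuousLinearMap.inr ℝ ℝ (Euc N))) :=
    intervalIntegral.integral_congr fun s hs => by
      simp only [hgd s hs]
      rfl
  have hint : IntervalIntegrable (fun s : ℝ => (contractTime (Euc N) q).comp
      ((fderiv ℝ w (s, y)).comp (ContinuousLinearMap.inr ℝ ℝ (Euc N)))) volume 0 1 := by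
    refine ContinuousOn.intervalIntegrable ?_
    exact continuousOn_const.clm_comp ((hDw.comp hline hmem).clm_comp continuousOn_const)
  ext v
  let ev : (Euc N [⋀^Fin (q + 1)]→L[ℝ] ℝ) →L[ℝ] ℝ :=
    ContinuousAlternatingMap.apply ℝ (Euc N) ℝ v
  let A := ev.comp (ContinuousAlternatingMap.alternatizeUncurryFinCLM ℝ (Euc N) ℝ (n := q))
  have h1 : extDeriv (fun y => ∫ s in (0 : ℝ)..1, contractTime (Euc N) q (w (s, y))) y v =
      A (∫ s in (0 : ℝ)..1, (contractTime (Euc N) q).comp ((fderiv ℝ w (s, y)).comp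
        (ContinuousLinearMap.inr ℝ ℝ (Euc N)))) := by
    rw [← hcongr, ← hK]
    rfl
  rw [h1, ← A.intervalIntegral_comp_comm hint]
  have h2 : ∀ s ∈ uIcc (0 : ℝ) 1, A ((contractTime (Euc N) q).comp ((fderiv ℝ w (s, y)).comp
        (ContinuousLinearMap.inr ℝ ℝ (Euc N)))) =
      fderiv ℝ w (s, y) (1, 0) fun i => (0, v i) := fun s hs =>
    alternatizeUncurryFin_contractTime _ (hd _ (hmem s hs)) v
  rw [intervalIntegral.integral_congr h2]
  have h3 : ∀ s ∈ uIcc (0 : ℝ) 1, HasDerivAt (fun s : ℝ => w (s, y) fun i => (0, v i))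
      (fderiv ℝ w (s, y) (1, 0) fun i => (0, v i)) s := fun s hs => by
    have hl : HasDerivAt (fun s : ℝ => (s, y)) ((1, 0) : ℝ × Euc N) s :=
      (hasDerivAt_id s).prodMk (hasDerivAt_const s y)
    have h4 := (hwd s hs).comp_hasDerivAt s hl
    exact (ContinuousAlternatingMap.apply ℝ (ℝ × Euc N) ℝ
      (fun i => ((0, v i) : ℝ × Euc N))).hasFDerivAt.comp_hasDerivAt s h4
  rw [intervalIntegral.integral_eq_sub_of_hasDerivAt h3]
  · rfl
  · refine ContinuousOn.intervalIntegrable ?_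
    exact (ContinuousAlternatingMap.apply ℝ (ℝ × Euc N) ℝ
      (fun i => ((0, v i) : ℝ × Euc N))).continuous.comp_continuousOn
      ((hDw.comp hline hmem).clm_apply continuousOn_const)

end Homotopy

section OpenForms

open TopologicalSpace (Opens)

variable {N m q : ℕ}

/-- The differential `q`-forms on `ℝᴺ`, without any regularity. A form on an open subset is
represented by any of its extensions to `ℝᴺ`. -/
abbrev EucForm (N q : ℕ) : Type := Euc N → Euc N [⋀^Fin q]→L[ℝ] ℝ

theorem extDeriv_congr_of_eqOn {w w' : EucForm N q} {V : Opens (Euc N)} (h : EqOn w w' V)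
    {y : Euc N} (hy : y ∈ V) : extDeriv w y = extDeriv w' y :=
  (h.eventuallyEq_of_mem (V.isOpen.mem_nhds hy)).extDeriv_eq

theorem differentiableAt_of_contDiffOn {w : EucForm N q} {V : Opens (Euc N)}
    (h : ContDiffOn ℝ ∞ w V) {y : Euc N} (hy : y ∈ V) : DifferentiableAt ℝ w y :=
  (h.contDiffAt (V.isOpen.mem_nhds hy)).differentiableAt (by simp)

/-- The forms that are smooth and closed on an open subset `V` of `ℝᴺ`. -/
def closedOn (V : Opens (Euc N)) (q : ℕ) : Submodule ℝ (EucForm N q) where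
  carrier := {w | ContDiffOn ℝ ∞ w V ∧ ∀ y ∈ V, extDeriv w y = 0}
  add_mem' := fun {a b} ha hb => ⟨ha.1.add hb.1, fun y hy => by
    rw [extDeriv_add (differentiableAt_of_contDiffOn ha.1 hy)
      (differentiableAt_of_contDiffOn hb.1 hy), ha.2 y hy, hb.2 y hy, add_zero]⟩
  zero_mem' := ⟨contDiffOn_const, fun y _ => by
    have h := extDeriv_smul (x := y) (0 : ℝ) (0 : EucForm N q)
    rwa [zero_smul, zero_smul] at h⟩
  smul_mem' := fun c a ha => ⟨ha.1.const_smul c, fun y hy => by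
    rw [extDeriv_smul, ha.2 y hy, smul_zero]⟩

/-- The forms whose restriction to an open subset `V` of `ℝᴺ` is exact. In degree `0` these are
the functions that vanish on `V`. -/
def exactOn (V : Opens (Euc N)) : (q : ℕ) → Submodule ℝ (EucForm N q)
  | 0 =>
    { carrier := {w | ∀ y ∈ V, w y = 0}
      add_mem' := fun {a b} ha hb y hy => by rw [Pi.add_apply, ha y hy, hb y hy, add_zero]
      zero_mem' := fun _ _ => rfl
      smul_mem' := fun c a ha y hy => by rw [Pi.smul_apply, ha y hy, smul_zero] }
  | q + 1 =>
    { carrier := {w | ∃ η : EucForm N q, ContDiffOn ℝ ∞ η V ∧ ∀ y ∈ V, extDeriv η y = w y}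
      add_mem' := by
        rintro a b ⟨η, hη, hηa⟩ ⟨θ, hθ, hθb⟩
        refine ⟨η + θ, hη.add hθ, fun y hy => ?_⟩
        rw [extDeriv_add (differentiableAt_of_contDiffOn hη hy)
          (differentiableAt_of_contDiffOn hθ hy), hηa y hy, hθb y hy, Pi.add_apply]
      zero_mem' := ⟨0, contDiffOn_const, (closedOn V q).zero_mem.2⟩
      smul_mem' := by
        rintro c a ⟨η, hη, hηa⟩
        exact ⟨c • η, hη.const_smul c, fun y hy => by
          rw [extDeriv_smul, hηa y hy, Pi.smul_apply]⟩ }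

theorem closedOn_mono {V V' : Opens (Euc N)} (h : V ≤ V') : closedOn V' q ≤ closedOn V q :=
  fun _ hw => ⟨hw.1.mono h, fun y hy => hw.2 y (h hy)⟩

theorem exactOn_congr {V : Opens (Euc N)} {w w' : EucForm N q} (h : EqOn w w' V)
    (hw : w ∈ exactOn V q) : w' ∈ exactOn V q := by
  cases q with
  | zero => exact fun y hy => (h hy).symm.trans (hw y hy)
  | succ q =>
    obtain ⟨η, hη, hηw⟩ := hw
    exact ⟨η, hη, fun y hy => (hηw y hy).trans (h hy)⟩

/-- Smoothness of a family of alternating maps on a finite-dimensional space can be tested on fixed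
vectors. -/
theorem contDiffOn_alternating_of_forall_apply {A E : Type*} [NormedAddCommGroup A]
    [NormedSpace ℝ A] [NormedAddCommGroup E] [NormedSpace ℝ E] [FiniteDimensional ℝ E]
    {w : A → E [⋀^Fin q]→L[ℝ] ℝ} {s : Set A}
    (h : ∀ v : Fin q → E, ContDiffOn ℝ ∞ (fun a => w a v) s) : ContDiffOn ℝ ∞ w s := by
  -- Transport to `ℝⁿ` along a linear equivalence `e`.
  let e : E ≃L[ℝ] Euc (Module.finrank ℝ E) :=
    ContinuousLinearEquiv.ofFinrankEq (by simp)
  let P : (Euc (Module.finrank ℝ E) [⋀^Fin q]→L[ℝ] ℝ) →L[ℝ] (E [⋀^Fin q]→L[ℝ] ℝ) :=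
    ContinuousAlternatingMap.compContinuousLinearMapCLM (e : E →L[ℝ] Euc (Module.finrank ℝ E))
  have h1 : ContDiffOn ℝ ∞
      (fun a => (w a).compContinuousLinearMap (e.symm : Euc (Module.finrank ℝ E) →L[ℝ] E)) s :=
    contDiffOn_alternating_of_apply fun v => h fun i => e.symm (v i)
  have h2 : w = fun a => P ((w a).compContinuousLinearMap (e.symm : Euc (Module.finrank ℝ E) →L[ℝ] E)) := by
    funext a
    ext v
    simp [P, Function.comp_def]
  rw [h2]
  exact P.contDiff.comp_contDiffOn h1

theorem contDiffOn_alternating_compContinuousLinearMap {A E G : Type*} [NormedAddCommGroup A]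
    [NormedSpace ℝ A] [NormedAddCommGroup E] [NormedSpace ℝ E] [FiniteDimensional ℝ E]
    [NormedAddCommGroup G] [NormedSpace ℝ G]
    {w : A → G [⋀^Fin q]→L[ℝ] ℝ} {g : A → E →L[ℝ] G} {s : Set A}
    (hw : ContDiffOn ℝ ∞ w s) (hg : ContDiffOn ℝ ∞ g s) :
    ContDiffOn ℝ ∞ (fun a => (w a).compContinuousLinearMap (g a)) s := by
  apply contDiffOn_alternating_of_forall_apply
  intro v
  have h1 : ContDiffOn ℝ ∞ (fun a =>
      ContinuousMultilinearMap.compContinuousLinearMapContinuousMultilinear ℝ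
        (fun _ : Fin q => E) (fun _ => G) ℝ (fun _ => g a)) s :=
    (ContinuousMultilinearMap.contDiff _).comp_contDiffOn (contDiffOn_pi.2 fun _ => hg)
  have h2 : ContDiffOn ℝ ∞ (fun a =>
      ContinuousAlternatingMap.toContinuousMultilinearMapCLM ℝ (w a)) s :=
    (ContinuousLinearMap.contDiff _).comp_contDiffOn hw
  have h3 := h1.clm_apply h2
  exact (ContinuousMultilinearMap.apply ℝ (fun _ : Fin q => E) ℝ v).contDiff.comp_contDiffOn h3

/-- The restrictions to the two ends of a closed form on a neighbourhood of `[0, 1] × O` are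
cohomologous. -/
theorem sub_mem_exactOn_of_closed {W : Set (ℝ × Euc N)} {O : Opens (Euc N)}
    {w : ℝ × Euc N → (ℝ × Euc N) [⋀^Fin q]→L[ℝ] ℝ} (hw : ContDiffOn ℝ ∞ w W)
    (hW : IsOpen W) (hWO : Icc (0 : ℝ) 1 ×ˢ (O : Set (Euc N)) ⊆ W)
    (hd : ∀ p ∈ W, extDeriv w p = 0) :
    (fun y => (w (1, y)).compContinuousLinearMap (ContinuousLinearMap.inr ℝ ℝ (Euc N)) -
        (w (0, y)).compContinuousLinearMap (ContinuousLinearMap.inr ℝ ℝ (Euc N))) ∈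
      exactOn O q := by
  cases q with
  | succ q =>
    exact ⟨_, contDiffOn_integral_unitInterval
      ((contractTime (Euc N) q).contDiff.comp_contDiffOn hw) hW O.isOpen hWO,
      fun y hy => extDeriv_integral_contractTime hw hW O.isOpen hWO hd hy⟩
  | zero =>
    -- A closed `0`-form is constant along the segment `[0, 1] × {y}`.
    intro y hy
    ext v
    have hmem : ∀ s ∈ uIcc (0 : ℝ) 1, (s, y) ∈ W := fun s hs => by
      rw [uIcc_of_le zero_le_one] at hs
      exact hWO ⟨hs, hy⟩
    have h3 : ∀ s ∈ uIcc (0 : ℝ) 1, HasDerivAt (fun s : ℝ => w (s, y) 0) 0 s := fun s hs => by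
      have hl : HasDerivAt (fun s : ℝ => (s, y)) ((1, 0) : ℝ × Euc N) s :=
        (hasDerivAt_id s).prodMk (hasDerivAt_const s y)
      have h4 := ((hw.contDiffAt (hW.mem_nhds (hmem s hs))).differentiableAt
        (by simp)).hasFDerivAt.comp_hasDerivAt s hl
      have h5 := DFunLike.congr_fun (hd _ (hmem s hs)) fun _ => ((1, 0) : ℝ × Euc N)
      have h6 : extDeriv w (s, y) (fun _ => ((1, 0) : ℝ × Euc N)) =
          fderiv ℝ w (s, y) (1, 0) 0 := by
        rw [extDeriv, ContinuousAlternatingMap.alternatizeUncurryFin_apply]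
        simp only [Fin.sum_univ_succ, Fin.val_zero, pow_zero, one_smul, Finset.univ_eq_empty,
          Finset.sum_empty, add_zero]
        congr 1
        exact Subsingleton.elim _ _
      have h7 : fderiv ℝ w (s, y) (1, 0) 0 = 0 := h6.symm.trans h5
      have h8 : HasDerivAt (fun s : ℝ => w (s, y) 0) (fderiv ℝ w (s, y) (1, 0) 0) s :=
        (ContinuousAlternatingMap.apply ℝ (ℝ × Euc N) ℝ
        (0 : Fin 0 → ℝ × Euc N)).hasFDerivAt.comp_hasDerivAt s h4
      rwa [h7] at h8
    have h9 := intervalIntegral.integral_eq_sub_of_hasDerivAt h3 intervalIntegrable_const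
    rw [intervalIntegral.integral_zero] at h9
    have h10 : ∀ s : ℝ, (w (s, y)).compContinuousLinearMap
        (ContinuousLinearMap.inr ℝ ℝ (Euc N)) v = w (s, y) 0 := fun s =>
      congrArg (w (s, y)) (Subsingleton.elim _ _)
    change (w (1, y)).compContinuousLinearMap _ v - (w (0, y)).compContinuousLinearMap _ v = 0
    rw [h10, h10, ← h9]

/-- The pullback of a form along a map between Euclidean spaces. -/
noncomputable def eucPullback (f : Euc m → Euc N) (w : EucForm N q) : EucForm m q :=
  fun y => (w (f y)).compContinuousLinearMap (fderiv ℝ f y)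

/-- Pullbacks of a closed form along two maps are cohomologous if the maps are joined by a
straight-line homotopy within the domain of the form. -/
theorem eucPullback_sub_mem_exactOn {O : Opens (Euc m)} {U : Opens (Euc N)}
    {f g : Euc m → Euc N} (hf : ContDiffOn ℝ ∞ f O) (hg : ContDiffOn ℝ ∞ g O)
    (hfg : ∀ y ∈ O, ∀ s ∈ Icc (0 : ℝ) 1, f y + s • (g y - f y) ∈ U)
    {w : EucForm N q} (hw : w ∈ closedOn U q) :
    eucPullback g w - eucPullback f w ∈ exactOn O q := by
  let H : ℝ × Euc m → Euc N := fun p => f p.2 + p.1 • (g p.2 - f p.2)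
  have hW₀ : IsOpen ((univ : Set ℝ) ×ˢ (O : Set (Euc m))) := isOpen_univ.prod O.isOpen
  have hsnd : MapsTo Prod.snd ((univ : Set ℝ) ×ˢ (O : Set (Euc m))) (O : Set (Euc m)) :=
    fun p hp => hp.2
  have hf' := hf.comp (contDiff_snd (E := ℝ)).contDiffOn hsnd
  have hg' := hg.comp (contDiff_snd (E := ℝ)).contDiffOn hsnd
  have hH : ContDiffOn ℝ ∞ H ((univ : Set ℝ) ×ˢ (O : Set (Euc m))) :=
    hf'.add (contDiff_fst.contDiffOn.smul (hg'.sub hf'))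
  let W : Set (ℝ × Euc m) := ((univ : Set ℝ) ×ˢ (O : Set (Euc m))) ∩ H ⁻¹' U
  have hW : IsOpen W := hH.continuousOn.isOpen_inter_preimage hW₀ U.isOpen
  have hHW : ContDiffOn ℝ ∞ H W := hH.mono inter_subset_left
  let Ω : ℝ × Euc m → (ℝ × Euc m) [⋀^Fin q]→L[ℝ] ℝ := fun p =>
    (w (H p)).compContinuousLinearMap (fderiv ℝ H p)
  have hΩ : ContDiffOn ℝ ∞ Ω W :=
    contDiffOn_alternating_compContinuousLinearMap (hw.1.comp hHW fun p hp => hp.2)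
      (hHW.fderiv_of_isOpen hW (by simp))
  have hd : ∀ p ∈ W, extDeriv Ω p = 0 := fun p hp => by
    rw [extDeriv_pullback (differentiableAt_of_contDiffOn hw.1 hp.2)
      (hHW.contDiffAt (hW.mem_nhds hp)) minSmoothness_two_le, hw.2 _ hp.2]
    rfl
  refine exactOn_congr (fun y hy => ?_) (sub_mem_exactOn_of_closed (O := O) hΩ hW
    (fun p hp => ⟨⟨mem_univ _, hp.2⟩, hfg _ hp.2 _ hp.1⟩) hd)
  have hslice : ∀ s : ℝ, (Ω (s, y)).compContinuousLinearMap (ContinuousLinearMap.inr ℝ ℝ (Euc m)) =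
      (w (H (s, y))).compContinuousLinearMap (fderiv ℝ (fun z => H (s, z)) y) := fun s => by
    have h1 : HasFDerivAt H (fderiv ℝ H (s, y)) (s, y) :=
      ((hH.contDiffAt (hW₀.mem_nhds ⟨mem_univ _, hy⟩)).differentiableAt (by simp)).hasFDerivAt
    have h2 : HasFDerivAt (fun z => H (s, z)) _ y := h1.comp y (hasFDerivAt_prodMk_right s y)
    rw [h2.fderiv]
    rfl
  have e1 : (fun z => H (1, z)) = g := by funext z; simp [H]
  have e0 : (fun z => H (0, z)) = f := by funext z; simp [H]
  simp only [hslice, e1, e0, Pi.sub_apply]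
  rw [show H (1, y) = g y from congrFun e1 y, show H (0, y) = f y from congrFun e0 y]
  rfl

end OpenForms

/-! ### Subspaces of finite dimension modulo another subspace -/

section FinMod

variable {X Y : Type*} [AddCommGroup X] [Module ℝ X] [AddCommGroup Y] [Module ℝ Y]

/-- The subspace `Z` has finite dimension modulo the subspace `B`, that is, `(Z + B) / B` is
finite-dimensional. It is not required that `B ≤ Z`. -/
def FinMod (B Z : Submodule ℝ X) : Prop := ∃ F : Submodule ℝ X, F.FG ∧ Z ≤ F ⊔ B

theorem FinMod.of_le {B Z : Submodule ℝ X} (h : Z ≤ B) : FinMod B Z :=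
  ⟨⊥, Submodule.fg_bot, by rwa [bot_sup_eq]⟩

theorem FinMod.mono {B B' Z Z' : Submodule ℝ X} (h : FinMod B Z) (hB : B ≤ B') (hZ : Z' ≤ Z) :
    FinMod B' Z' := by
  obtain ⟨F, hF, hZF⟩ := h
  exact ⟨F, hF, hZ.trans (hZF.trans (sup_le_sup_left hB F))⟩

theorem FinMod.trans {A B Z : Submodule ℝ X} (h : FinMod B Z) (h' : FinMod A B) :
    FinMod A Z := by
  obtain ⟨F, hF, hZF⟩ := h
  obtain ⟨F', hF', hBF'⟩ := h'
  refine ⟨F ⊔ F', hF.sup hF', hZF.trans ?_⟩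
  rw [sup_assoc]
  exact sup_le_sup_left hBF' F

theorem FinMod.map {B Z : Submodule ℝ X} (h : FinMod B Z) (f : X →ₗ[ℝ] Y) :
    FinMod (B.map f) (Z.map f) := by
  obtain ⟨F, hF, hZF⟩ := h
  refine ⟨F.map f, hF.map f, ?_⟩
  rw [← Submodule.map_sup]
  exact Submodule.map_mono hZF

/-- A linear map with values in a space of finite dimension modulo `C` has a kernel of finite
codimension modulo `C`. -/
theorem FinMod.inf_comap {Z : Submodule ℝ X} {C : Submodule ℝ Y} (f : X →ₗ[ℝ] Y)
    (h : FinMod C (Z.map f)) : FinMod (Z ⊓ C.comap f) Z := by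
  obtain ⟨F, hF, hZF⟩ := h
  let g : Z →ₗ[ℝ] Y ⧸ C := C.mkQ ∘ₗ f ∘ₗ Z.subtype
  have hF' : FiniteDimensional ℝ (F.map C.mkQ) := Module.Finite.iff_fg.2 (hF.map _)
  have hg : ∀ z : Z, g z ∈ F.map C.mkQ := fun z => by
    obtain ⟨a, ha, b, hb, hab⟩ := Submodule.mem_sup.1 (hZF ⟨z.1, z.2, rfl⟩)
    refine ⟨a, ha, ?_⟩
    change C.mkQ a = C.mkQ (f z.1)
    have hb' : C.mkQ b = 0 := (Submodule.Quotient.mk_eq_zero C).2 hb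
    rw [← hab, map_add, hb', add_zero]
  -- A complement of the kernel embeds into a finite-dimensional space.
  obtain ⟨Q, hQ⟩ := Submodule.exists_isCompl (LinearMap.ker g)
  have hQf : FiniteDimensional ℝ Q := by
    refine FiniteDimensional.of_injective
      ((g.codRestrict (F.map C.mkQ) hg).comp Q.subtype) ?_
    rw [← LinearMap.ker_eq_bot, LinearMap.ker_eq_bot']
    intro x hx
    have h1 : g x.1 = 0 := congrArg Subtype.val hx
    have h2 : x.1 ∈ LinearMap.ker g ⊓ Q := ⟨h1, x.2⟩
    rw [hQ.inf_eq_bot] at h2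
    exact Subtype.ext h2
  refine ⟨Q.map Z.subtype, (Module.Finite.iff_fg.1 hQf).map _, fun z hz => ?_⟩
  have hz' : (⟨z, hz⟩ : Z) ∈ LinearMap.ker g ⊔ Q := by rw [hQ.sup_eq_top]; trivial
  obtain ⟨a, ha, b, hb, hab⟩ := Submodule.mem_sup.1 hz'
  refine Submodule.mem_sup.2 ⟨b.1, ⟨b, hb, rfl⟩, a.1, ⟨a.2, ?_⟩, ?_⟩
  · exact (Submodule.Quotient.mk_eq_zero C).1 ha
  · rw [add_comm]
    exact congrArg Subtype.val hab

end FinMod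

/-! ### The Poincaré lemma -/

section OpenForms

open TopologicalSpace (Opens)

variable {N q : ℕ}

/-- The de Rham cohomology of the open subset `V` of `ℝᴺ` is finite-dimensional. -/
def HasFiniteCohomology (V : Opens (Euc N)) : Prop :=
  ∀ q, FinMod (exactOn V q) (closedOn V q)

/-- Poincaré lemma: convex open sets have the cohomology of a point (or of the empty set). -/
theorem hasFiniteCohomology_of_convex {V : Opens (Euc N)} (hV : Convex ℝ (V : Set (Euc N))) :
    HasFiniteCohomology V := by
  intro q
  rcases (V : Set (Euc N)).eq_empty_or_nonempty with hempty | ⟨c, hc⟩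
  · refine FinMod.of_le fun w _ => exactOn_congr (w := 0) (fun y hy => ?_) (Submodule.zero_mem _)
    rw [hempty] at hy
    exact hy.elim
  -- The straight-line homotopy from the constant map `c` to the identity.
  have key : ∀ w ∈ closedOn V q, w - eucPullback (fun _ => c) w ∈ exactOn V q := fun w hw => by
    refine exactOn_congr (fun y _ => ?_) (eucPullback_sub_mem_exactOn (O := V) (U := V)
      (f := fun _ => c) (g := id) contDiffOn_const contDiffOn_id (fun y hy s hs => ?_) hw)
    · rw [Pi.sub_apply, Pi.sub_apply]
      congr 1
      ext v
      simp [eucPullback]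
    · exact hV.add_smul_sub_mem hc hy hs
  -- The pullback along the constant map is a constant form.
  let const : (Euc N [⋀^Fin q]→L[ℝ] ℝ) →ₗ[ℝ] EucForm N q :=
    { toFun := fun a _ => a
      map_add' := fun _ _ => rfl
      map_smul' := fun _ _ => rfl }
  have hpull : ∀ w : EucForm N q, eucPullback (fun _ : Euc N => c) w ∈ LinearMap.range const := by
    intro w
    refine ⟨(w c).compContinuousLinearMap 0, ?_⟩
    funext y
    simp [eucPullback, const]
  have hfin : FiniteDimensional ℝ (Euc N [⋀^Fin q]→L[ℝ] ℝ) := by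
    exact FiniteDimensional.of_injective
      ((AlternatingMap.toMultilinearMapLM (S := ℝ)).comp
        (ContinuousAlternatingMap.toAlternatingMapLinear (R := ℝ) (A := ℝ) (M := Euc N) (N := ℝ)
          (ι := Fin q)))
      (AlternatingMap.coe_multilinearMap_injective.comp
        ContinuousAlternatingMap.toAlternatingMap_injective)
  refine ⟨LinearMap.range const, ?_, fun w hw => ?_⟩
  · rw [LinearMap.range_eq_map]
    exact (Module.finite_def.1 hfin).map const
  · exact Submodule.mem_sup.2 ⟨_, hpull w, _, key w hw, add_sub_cancel _ _⟩

/-! ### The Mayer–Vietoris argument -/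

theorem contDiffOn_extDeriv {w : EucForm N q} {V : Opens (Euc N)} (hw : ContDiffOn ℝ ∞ w V) :
    ContDiffOn ℝ ∞ (extDeriv w) V :=
  ContDiff.comp_contDiffOn
    (g := ContinuousAlternatingMap.alternatizeUncurryFinCLM ℝ (Euc N) ℝ (n := q))
    (ContinuousLinearMap.contDiff _) (hw.fderiv_of_isOpen V.isOpen (by simp))

theorem extDeriv_sub_of_contDiffOn {V : Opens (Euc N)} {a b : EucForm N q}
    (ha : ContDiffOn ℝ ∞ a V) (hb : ContDiffOn ℝ ∞ b V) {y : Euc N} (hy : y ∈ V) :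
    extDeriv (a - b) y = extDeriv a y - extDeriv b y := by
  change ContinuousAlternatingMap.alternatizeUncurryFinCLM ℝ (Euc N) ℝ (fderiv ℝ (a - b) y) = _
  rw [fderiv_sub (differentiableAt_of_contDiffOn ha hy) (differentiableAt_of_contDiffOn hb hy),
    map_sub]
  rfl

/-- A smooth function on `W ∪ C` that is `0` near `C \ W` and `1` near `W \ C`. -/
theorem exists_smooth_separation (W C : Opens (Euc N)) :
    ∃ φ : Euc N → ℝ, ContDiffOn ℝ ∞ φ (W ⊔ C : Opens (Euc N)) ∧
      (∀ y ∈ C, y ∉ W → φ =ᶠ[𝓝 y] 0) ∧ ∀ y ∈ W, y ∉ C → φ =ᶠ[𝓝 y] 1 := by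
  obtain ⟨a, ha, has, har⟩ := W.isOpen.exists_contDiff_support_eq (n := ⊤)
  obtain ⟨b, hb, hbs, hbr⟩ := C.isOpen.exists_contDiff_support_eq (n := ⊤)
  have ha0 : ∀ y, 0 ≤ a y := fun y => (har ⟨y, rfl⟩).1
  have hb0 : ∀ y, 0 ≤ b y := fun y => (hbr ⟨y, rfl⟩).1
  have haW : ∀ y, a y ≠ 0 ↔ y ∈ W := fun y => Set.ext_iff.1 ha y
  have hbC : ∀ y, b y ≠ 0 ↔ y ∈ C := fun y => Set.ext_iff.1 hb y
  have hpos : ∀ y ∈ (W ⊔ C : Opens (Euc N)), a y + b y ≠ 0 := by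
    intro y hy h
    have h1 : a y = 0 := by linarith [ha0 y, hb0 y]
    have h2 : b y = 0 := by linarith [ha0 y, hb0 y]
    rcases hy with hy | hy
    · exact (haW y).2 hy h1
    · exact (hbC y).2 hy h2
  have hχ : ContDiffOn ℝ ∞ (fun y => 3 * (a y / (a y + b y)) - 1) (W ⊔ C : Opens (Euc N)) :=
    (contDiffOn_const.mul (has.contDiffOn.div (has.add hbs).contDiffOn hpos)).sub contDiffOn_const
  have hcont : ∀ y ∈ (W ⊔ C : Opens (Euc N)),
      ContinuousAt (fun y => 3 * (a y / (a y + b y)) - 1) y := fun y hy =>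
    hχ.continuousOn.continuousAt ((W ⊔ C).isOpen.mem_nhds hy)
  -- `a / (a + b)` vanishes on `C \ W` but not near it; the smooth step makes it constant near the
  -- places where it is `0` or `1`.
  refine ⟨fun y => Real.smoothTransition (3 * (a y / (a y + b y)) - 1),
    Real.smoothTransition.contDiff.comp_contDiffOn hχ, fun y hy hyW => ?_, fun y hy hyC => ?_⟩
  · have h0 : a y = 0 := not_not.1 fun h => hyW ((haW y).1 h)
    have hlt : 3 * (a y / (a y + b y)) - 1 < 0 := by rw [h0]; norm_num
    filter_upwards [(hcont y (Or.inr hy)).eventually (gt_mem_nhds hlt)] with z hz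
    exact Real.smoothTransition.zero_of_nonpos hz.le
  · have h0 : b y = 0 := not_not.1 fun h => hyC ((hbC y).1 h)
    have hlt : 1 < 3 * (a y / (a y + b y)) - 1 := by
      rw [h0, add_zero, div_self ((haW y).2 hy)]; norm_num
    filter_upwards [(hcont y (Or.inl hy)).eventually (lt_mem_nhds hlt)] with z hz
    exact Real.smoothTransition.one_of_one_le hz.le

/-- If `ψ` is smooth on `W` and vanishes near `W \ C`, then the extension by zero of `ψ γ`, for `γ`
smooth on `W ∩ C`, is smooth on `W`. -/
theorem contDiffOn_indicator_smul {W C : Opens (Euc N)} {ψ : Euc N → ℝ} {γ : EucForm N q}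
    (hψ : ContDiffOn ℝ ∞ ψ W) (hγ : ContDiffOn ℝ ∞ γ (W ⊓ C : Opens (Euc N)))
    (h0 : ∀ y ∈ W, y ∉ C → ψ =ᶠ[𝓝 y] 0) :
    ContDiffOn ℝ ∞ ((C : Set (Euc N)).indicator fun y => ψ y • γ y) W := by
  intro y hy
  refine ContDiffAt.contDiffWithinAt ?_
  by_cases hyC : y ∈ C
  · have h1 : ContDiffAt ℝ ∞ (fun y => ψ y • γ y) y :=
      (hψ.contDiffAt (W.isOpen.mem_nhds hy)).smul
        (hγ.contDiffAt ((W ⊓ C).isOpen.mem_nhds ⟨hy, hyC⟩))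
    refine h1.congr_of_eventuallyEq ?_
    filter_upwards [C.isOpen.mem_nhds hyC] with z hz
    exact indicator_of_mem hz _
  · refine (contDiffAt_const (c := 0)).congr_of_eventuallyEq ?_
    filter_upwards [h0 y hy hyC] with z hz
    by_cases hzC : z ∈ (C : Set (Euc N))
    · rw [indicator_of_mem hzC, hz, Pi.zero_apply, zero_smul]
    · exact indicator_of_notMem hzC _

/-- Forms on `W` and on `C` that agree on the overlap glue. -/
theorem exists_glue_of_eqOn {W C : Opens (Euc N)} {α β : EucForm N q}
    (hα : ContDiffOn ℝ ∞ α W) (hβ : ContDiffOn ℝ ∞ β C)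
    (h : ∀ y ∈ W, y ∈ C → α y = β y) :
    ∃ θ : EucForm N q, ContDiffOn ℝ ∞ θ (W ⊔ C : Opens (Euc N)) ∧
      (∀ y ∈ W, extDeriv θ y = extDeriv α y) ∧ ∀ y ∈ C, extDeriv θ y = extDeriv β y := by
  classical
  let θ : EucForm N q := fun y => if y ∈ W then α y else β y
  have h1 : EqOn θ α W := fun y hy => if_pos hy
  have h2 : EqOn θ β C := fun y hy => by
    by_cases hyW : y ∈ W
    · exact (if_pos hyW).trans (h y hyW hy)
    · exact if_neg hyW
  refine ⟨θ, ?_, fun y hy => extDeriv_congr_of_eqOn h1 hy, fun y hy => extDeriv_congr_of_eqOn h2 hy⟩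
  rintro y (hy | hy)
  · exact (((hα.congr h1).contDiffAt (W.isOpen.mem_nhds hy))).contDiffWithinAt
  · exact (((hβ.congr h2).contDiffAt (C.isOpen.mem_nhds hy))).contDiffWithinAt

/-- Forms on `W` and on `C` whose difference is exact on the overlap glue after the addition of
exact forms. -/
theorem exists_glue_of_sub_mem_exactOn {W C : Opens (Euc N)} {α β : EucForm N q}
    (hα : ContDiffOn ℝ ∞ α W) (hβ : ContDiffOn ℝ ∞ β C) (h : α - β ∈ exactOn (W ⊓ C) q) :
    ∃ θ : EucForm N q, ContDiffOn ℝ ∞ θ (W ⊔ C : Opens (Euc N)) ∧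
      (∀ y ∈ W, extDeriv θ y = extDeriv α y) ∧ ∀ y ∈ C, extDeriv θ y = extDeriv β y := by
  cases q with
  | zero => exact exists_glue_of_eqOn hα hβ fun y hyW hyC => sub_eq_zero.1 (h y ⟨hyW, hyC⟩)
  | succ q =>
    obtain ⟨γ, hγ, hγd⟩ := h
    obtain ⟨φ, hφ, hφ0, hφ1⟩ := exists_smooth_separation W C
    -- `γ = γ₁ - γ₂` on the overlap, where `γ₁` is smooth on `W` and `γ₂` on `C`.
    let γ₁ : EucForm N q := (C : Set (Euc N)).indicator fun y => (1 - φ y) • γ y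
    let γ₂ : EucForm N q := (W : Set (Euc N)).indicator fun y => (-φ y) • γ y
    have hγ₁ : ContDiffOn ℝ ∞ γ₁ W := by
      refine contDiffOn_indicator_smul (contDiffOn_const.sub (hφ.mono le_sup_left)) hγ ?_
      intro y hyW hyC
      filter_upwards [hφ1 y hyW hyC] with z hz
      rw [hz, Pi.one_apply, sub_self, Pi.zero_apply]
    have hγ₂ : ContDiffOn ℝ ∞ γ₂ C := by
      refine contDiffOn_indicator_smul (hφ.mono le_sup_right).neg (by rwa [inf_comm]) ?_
      intro y hyC hyW
      filter_upwards [hφ0 y hyC hyW] with z hz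
      rw [hz, Pi.zero_apply, neg_zero]
    have hγ₁₂ : EqOn γ (γ₁ - γ₂) (W ⊓ C : Opens (Euc N)) := by
      intro y hy
      have e1 : γ₁ y = (1 - φ y) • γ y := indicator_of_mem hy.2 _
      have e2 : γ₂ y = (-φ y) • γ y := indicator_of_mem hy.1 _
      rw [Pi.sub_apply, e1, e2]
      ext v
      change γ y v = (1 - φ y) * γ y v - -φ y * γ y v
      ring
    have hdd : ∀ {V : Opens (Euc N)} {η : EucForm N q} {ζ : EucForm N (q + 1)},
        ContDiffOn ℝ ∞ η V → ContDiffOn ℝ ∞ ζ V → ∀ y ∈ V,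
        extDeriv (ζ - extDeriv η) y = extDeriv ζ y := fun hη hζ y hy => by
      rw [extDeriv_sub_of_contDiffOn hζ (contDiffOn_extDeriv hη) hy,
        extDeriv_extDeriv_apply (hη.contDiffAt (Opens.isOpen _ |>.mem_nhds hy))
          minSmoothness_two_le, sub_zero]
    obtain ⟨θ, hθ, hθW, hθC⟩ := exists_glue_of_eqOn (hα.sub (contDiffOn_extDeriv hγ₁))
      (hβ.sub (contDiffOn_extDeriv hγ₂)) fun y hyW hyC => by
        have e1 := hγd y ⟨hyW, hyC⟩
        rw [extDeriv_congr_of_eqOn hγ₁₂ (y := y) ⟨hyW, hyC⟩,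
          extDeriv_sub_of_contDiffOn (V := W ⊓ C) (hγ₁.mono inf_le_left)
            (hγ₂.mono inf_le_right) ⟨hyW, hyC⟩, Pi.sub_apply] at e1
        change α y - extDeriv γ₁ y = β y - extDeriv γ₂ y
        rw [sub_eq_sub_iff_sub_eq_sub, e1]
    exact ⟨θ, hθ, fun y hy => (hθW y hy).trans (hdd hγ₁ hα y hy),
      fun y hy => (hθC y hy).trans (hdd hγ₂ hβ y hy)⟩

/-- Exactness of the Mayer–Vietoris sequence, as used for finite-dimensionality: a closed form
that is exact on `W` and on `C` is determined, up to exact forms, by the class on `W ∩ C` of the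
difference of two primitives. -/
theorem HasFiniteCohomology.sup {W C : Opens (Euc N)} (hW : HasFiniteCohomology W)
    (hC : HasFiniteCohomology C) (hWC : HasFiniteCohomology (W ⊓ C)) :
    HasFiniteCohomology (W ⊔ C) := by
  intro q
  let Z := closedOn (W ⊔ C) q
  have h1 : FinMod (Z ⊓ exactOn W q) Z :=
    FinMod.inf_comap LinearMap.id (by
      rw [Submodule.map_id]
      exact (hW q).mono le_rfl (closedOn_mono le_sup_left))
  have h2 : FinMod ((Z ⊓ exactOn W q) ⊓ exactOn C q) (Z ⊓ exactOn W q) :=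
    FinMod.inf_comap LinearMap.id (by
      rw [Submodule.map_id]
      exact (hC q).mono le_rfl (inf_le_left.trans (closedOn_mono le_sup_right)))
  refine (h1.trans h2).trans ?_
  cases q with
  | zero =>
    refine FinMod.of_le fun w hw y hy => ?_
    rcases hy with hy | hy
    · exact hw.1.2 y hy
    · exact hw.2 y hy
  | succ q =>
    -- Closed forms `w` together with primitives `α` on `W` and `β` on `C`.
    let T : Submodule ℝ (EucForm N (q + 1) × EucForm N q × EucForm N q) :=
      { carrier := {p | (ContDiffOn ℝ ∞ p.2.1 W ∧ ∀ y ∈ W, extDeriv p.2.1 y = p.1 y) ∧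
          ContDiffOn ℝ ∞ p.2.2 C ∧ ∀ y ∈ C, extDeriv p.2.2 y = p.1 y}
        add_mem' := by
          rintro p p' ⟨⟨h1, h2⟩, h3, h4⟩ ⟨⟨h1', h2'⟩, h3', h4'⟩
          refine ⟨⟨h1.add h1', fun y hy => ?_⟩, h3.add h3', fun y hy => ?_⟩
          · change extDeriv (p.2.1 + p'.2.1) y = p.1 y + p'.1 y
            rw [extDeriv_add (differentiableAt_of_contDiffOn h1 hy)
              (differentiableAt_of_contDiffOn h1' hy), h2 y hy, h2' y hy]
          · change extDeriv (p.2.2 + p'.2.2) y = p.1 y + p'.1 y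
            rw [extDeriv_add (differentiableAt_of_contDiffOn h3 hy)
              (differentiableAt_of_contDiffOn h3' hy), h4 y hy, h4' y hy]
        zero_mem' := ⟨(closedOn W q).zero_mem, (closedOn C q).zero_mem⟩
        smul_mem' := by
          rintro c p ⟨⟨h1, h2⟩, h3, h4⟩
          refine ⟨⟨h1.const_smul c, fun y hy => ?_⟩, h3.const_smul c, fun y hy => ?_⟩
          · change extDeriv (c • p.2.1) y = c • p.1 y
            rw [extDeriv_smul, h2 y hy]
          · change extDeriv (c • p.2.2) y = c • p.1 y
            rw [extDeriv_smul, h4 y hy] }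
    -- The difference of the two primitives is closed on `W ∩ C`.
    let δ : EucForm N (q + 1) × EucForm N q × EucForm N q →ₗ[ℝ] EucForm N q :=
      (LinearMap.fst ℝ _ _ - LinearMap.snd ℝ _ _) ∘ₗ LinearMap.snd ℝ _ _
    have hδ : T.map δ ≤ closedOn (W ⊓ C) q := by
      rintro _ ⟨p, ⟨⟨h1, h2⟩, h3, h4⟩, rfl⟩
      have h1' := h1.mono (inf_le_left : (W : Set (Euc N)) ⊓ C ≤ W)
      have h3' := h3.mono (inf_le_right : (W : Set (Euc N)) ⊓ C ≤ C)
      refine ⟨h1'.sub h3', fun y hy => ?_⟩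
      change extDeriv (p.2.1 - p.2.2) y = 0
      rw [extDeriv_sub_of_contDiffOn (V := W ⊓ C) h1' h3' hy, h2 y hy.1, h4 y hy.2, sub_self]
    have h3 := (FinMod.inf_comap δ ((hWC q).mono le_rfl hδ)).map (LinearMap.fst ℝ _ _)
    refine h3.mono ?_ ?_
    · rintro _ ⟨p, ⟨⟨⟨h1, h2⟩, h3, h4⟩, hp⟩, rfl⟩
      obtain ⟨θ, hθ, hθW, hθC⟩ := exists_glue_of_sub_mem_exactOn h1 h3 hp
      refine ⟨θ, hθ, ?_⟩
      rintro y (hy | hy)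
      · exact (hθW y hy).trans (h2 y hy)
      · exact (hθC y hy).trans (h4 y hy)
    · rintro w ⟨⟨_, α, hα, hαw⟩, β, hβ, hβw⟩
      exact ⟨(w, α, β), ⟨⟨hα, hαw⟩, hβ, hβw⟩, rfl⟩

/-- A finite union of convex open sets has finite-dimensional cohomology, because its
intersection with a further convex open set is a union of fewer convex sets. -/
theorem hasFiniteCohomology_biUnion {ι : Type*} (s : Finset ι) (c : ι → Opens (Euc N))
    (hc : ∀ i, Convex ℝ (c i : Set (Euc N))) : HasFiniteCohomology (s.sup c) := by
  classical
  induction s using Finset.induction_on generalizing c with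
  | empty => exact hasFiniteCohomology_of_convex convex_empty
  | insert a s _ ih =>
    rw [Finset.sup_insert]
    refine (hasFiniteCohomology_of_convex (hc a)).sup (ih c hc) ?_
    rw [Finset.sup_inf_distrib_left]
    exact ih (fun i => c a ⊓ c i) fun i => (hc a).inter (hc i)

end OpenForms

/-! ### A smooth retraction onto an embedded compact manifold -/

section Retraction

open scoped RealInnerProductSpace

variable {n N : ℕ}

/-- Near `(u₀, h u₀)`, where `h` is an immersion at `u₀`, the critical points `u` of the distance
from `h u` to `y` are given by a smooth function `ρ` of `y`. -/
theorem exists_smooth_criticalPoint {h : Euc n → Euc N} {T : Set (Euc n)} (hT : IsOpen T)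
    (hh : ContDiffOn ℝ ∞ h T) {u₀ : Euc n} (hu₀ : u₀ ∈ T)
    (hinj : Function.Injective (fderiv ℝ h u₀)) :
    ∃ ρ : Euc N → Euc n, ∀ᶠ p in 𝓝 (u₀, h u₀),
      (∀ v, ⟪h p.1 - p.2, fderiv ℝ h p.1 v⟫ = 0) → ρ p.2 = p.1 ∧ ContDiffAt ℝ ∞ ρ p.2 := by
  let b := (EuclideanSpace.basisFun (Fin n) ℝ).toBasis
  let G : Euc n × Euc N → Fin n → ℝ := fun p i => ⟪h p.1 - p.2, fderiv ℝ h p.1 (b i)⟫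
  -- The critical points for `y` are the solutions `u` of `Ψ (u, y) = (0, y)`.
  let Ψ : Euc n × Euc N → (Fin n → ℝ) × Euc N := fun p => (G p, p.2)
  have hfst : MapsTo Prod.fst (T ×ˢ (univ : Set (Euc N))) T := fun p hp => hp.1
  have hS : IsOpen (T ×ˢ (univ : Set (Euc N))) := hT.prod isOpen_univ
  have hDh : ContDiffOn ℝ ∞ (fderiv ℝ h) T := hh.fderiv_of_isOpen hT (by simp)
  have hΨ : ContDiffOn ℝ ∞ Ψ (T ×ˢ (univ : Set (Euc N))) := by
    refine ContDiffOn.prodMk (contDiffOn_pi.2 fun i => ?_) contDiff_snd.contDiffOn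
    exact ((hh.comp contDiff_fst.contDiffOn hfst).sub contDiff_snd.contDiffOn).inner ℝ
      ((hDh.comp contDiff_fst.contDiffOn hfst).clm_apply contDiffOn_const)
  have hp₀ : (u₀, h u₀) ∈ T ×ˢ (univ : Set (Euc N)) := ⟨hu₀, mem_univ _⟩
  have hΨ₀ : ContDiffAt ℝ ∞ Ψ (u₀, h u₀) := hΨ.contDiffAt (hS.mem_nhds hp₀)
  have hΨd : HasFDerivAt Ψ (fderiv ℝ Ψ (u₀, h u₀)) (u₀, h u₀) :=
    (hΨ₀.differentiableAt (by simp)).hasFDerivAt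
  have hΨinj : Function.Injective (fderiv ℝ Ψ (u₀, h u₀)) := by
    rw [injective_iff_map_eq_zero]
    rintro ⟨v, w⟩ hvw
    have h2 : HasFDerivAt (fun p : Euc n × Euc N => p.2)
        ((ContinuousLinearMap.snd ℝ _ _).comp (fderiv ℝ Ψ (u₀, h u₀))) (u₀, h u₀) :=
      hΨd.snd
    have hw : w = 0 := by
      have h3 := DFunLike.congr_fun (h2.unique hasFDerivAt_snd) (v, w)
      rw [ContinuousLinearMap.comp_apply, hvw] at h3
      exact h3.symm
    have hdh : HasFDerivAt h (fderiv ℝ h u₀) u₀ :=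
      ((hh.contDiffAt (hT.mem_nhds hu₀)).differentiableAt (by simp)).hasFDerivAt
    have hdDh : HasFDerivAt (fderiv ℝ h) (fderiv ℝ (fderiv ℝ h) u₀) u₀ :=
      ((hDh.contDiffAt (hT.mem_nhds hu₀)).differentiableAt (by simp)).hasFDerivAt
    have horth : ∀ i, ⟪fderiv ℝ h u₀ v, fderiv ℝ h u₀ (b i)⟫ = 0 := by
      intro i
      have h4 : HasFDerivAt (fun p : Euc n × Euc N => G p i)
          ((ContinuousLinearMap.proj i).comp
            ((ContinuousLinearMap.fst ℝ _ _).comp (fderiv ℝ Ψ (u₀, h u₀)))) (u₀, h u₀) :=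
        hasFDerivAt_pi'.1 hΨd.fst i
      have h5 : HasFDerivAt (fun p : Euc n × Euc N => h p.1 - p.2)
          ((fderiv ℝ h u₀).comp (ContinuousLinearMap.fst ℝ _ _) -
            ContinuousLinearMap.snd ℝ _ _) (u₀, h u₀) :=
        (hdh.comp (u₀, h u₀) hasFDerivAt_fst).sub hasFDerivAt_snd
      have h6 := (hdDh.comp (u₀, h u₀) (hasFDerivAt_fst (𝕜 := ℝ) (E := Euc n) (F := Euc N)
        (p := (u₀, h u₀)))).clm_apply (hasFDerivAt_const (b i) (u₀, h u₀))
      have h7 := DFunLike.congr_fun (h4.unique (h5.inner ℝ h6)) (v, w)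
      have h8 : ((ContinuousLinearMap.proj (R := ℝ) (φ := fun _ : Fin n => ℝ) i).comp
            ((ContinuousLinearMap.fst ℝ _ _).comp (fderiv ℝ Ψ (u₀, h u₀)))) (v, w) = 0 := by
        simp only [ContinuousLinearMap.comp_apply, hvw, map_zero]
      rw [h8] at h7
      simpa [fderivInnerCLM_apply, hw] using h7.symm
    have hlin : (innerₛₗ ℝ (fderiv ℝ h u₀ v)).comp (fderiv ℝ h u₀ : Euc n →ₗ[ℝ] Euc N) = 0 :=
      b.ext fun i => by simpa using horth i
    have hvv : ⟪fderiv ℝ h u₀ v, fderiv ℝ h u₀ v⟫ = 0 := by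
      simpa using LinearMap.congr_fun hlin v
    have hv : v = 0 := hinj (by rw [inner_self_eq_zero.1 hvv, map_zero])
    rw [hv, hw]
    rfl
  let A : (Euc n × Euc N) ≃L[ℝ] (Fin n → ℝ) × Euc N :=
    ((fderiv ℝ Ψ (u₀, h u₀) : Euc n × Euc N →ₗ[ℝ] (Fin n → ℝ) × Euc N).linearEquivOfInjective
      hΨinj (by simp)).toContinuousLinearEquiv
  have hA : (A : Euc n × Euc N →L[ℝ] (Fin n → ℝ) × Euc N) = fderiv ℝ Ψ (u₀, h u₀) := by
    exact ContinuousLinearMap.ext fun p => rfl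
  have hΨA : HasFDerivAt Ψ (A : Euc n × Euc N →L[ℝ] (Fin n → ℝ) × Euc N) (u₀, h u₀) := by
    rw [hA]; exact hΨd
  let Θ := hΨ₀.toOpenPartialHomeomorph Ψ hΨA (by simp)
  have hΘ : ∀ p, Θ p = Ψ p := fun p => rfl
  refine ⟨fun y => (Θ.symm (0, y)).1, ?_⟩
  have hsrc : ∀ᶠ p in 𝓝 (u₀, h u₀), p ∈ Θ.source :=
    Θ.open_source.mem_nhds (hΨ₀.mem_toOpenPartialHomeomorph_source hΨA (by simp))
  have hinv : ∀ᶠ p in 𝓝 (u₀, h u₀), fderiv ℝ Ψ p ∈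
      range ((↑) : ((Euc n × Euc N) ≃L[ℝ] (Fin n → ℝ) × Euc N) → _) := by
    have hc : ContinuousAt (fderiv ℝ Ψ) (u₀, h u₀) :=
      (hΨ.continuousOn_fderiv_of_isOpen hS (by simp)).continuousAt (hS.mem_nhds hp₀)
    exact hc (by rw [← hA]; exact A.nhds)
  filter_upwards [hsrc, hinv, hS.mem_nhds hp₀] with p hp ⟨B, hB⟩ hpS hcrit
  have hΨp : Ψ p = (0, p.2) := Prod.ext (funext fun i => hcrit (b i)) rfl
  have hback : Θ.symm (0, p.2) = p := by rw [← hΨp, ← hΘ, Θ.left_inv hp]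
  refine ⟨by rw [hback], ?_⟩
  have hsm : ContDiffAt ℝ ∞ Θ.symm (0, p.2) := by
    refine Θ.contDiffAt_symm (f₀' := B) ?_ ?_ ?_
    · rw [← hΨp, ← hΘ]; exact Θ.map_source hp
    · rw [hback, hB]
      exact ((hΨ.contDiffAt (hS.mem_nhds hpS)).differentiableAt (by simp)).hasFDerivAt
    · rw [hback]; exact hΨ.contDiffAt (hS.mem_nhds hpS)
  exact contDiffAt_fst.comp p.2 (hsm.comp p.2 (contDiffAt_const.prodMk contDiffAt_id))

end Retraction

section ManifoldRetraction

open TopologicalSpace (Opens)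
open scoped RealInnerProductSpace

variable {n N : ℕ} {M : Type*} [TopologicalSpace M] [ChartedSpace (Euc n) M]
  [IsManifold (𝓡 n) ∞ M]

theorem injective_mfderiv_extChartAt_symm {x₀ : M} {y : Euc n}
    (hy : y ∈ (extChartAt (𝓡 n) x₀).target) :
    Function.Injective (mfderiv (𝓡 n) (𝓡 n) (extChartAt (𝓡 n) x₀).symm y) := by
  have : IsManifold (𝓡 n) 1 M := IsManifold.of_le (n := ∞) (by simp)
  have h := mfderiv_extChartAt_comp_mfderivWithin_extChartAt_symm (I := 𝓡 n) hy
  rw [ModelWithCorners.range_eq_univ, mfderivWithin_univ] at h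
  exact Function.LeftInverse.injective (g := mfderiv (𝓡 n) (𝓡 n) (extChartAt (𝓡 n) x₀)
    ((extChartAt (𝓡 n) x₀).symm y)) fun v => DFunLike.congr_fun h v

/-- The nearest-point map `r` to a compact embedded submanifold `e(M)` is smooth near `e(M)`:
the nearest points are critical points of the distance. -/
theorem eventually_contMDiffAt_nearestPoint {e : M → Euc N} (he : ContMDiff (𝓡 n) (𝓡 N) ∞ e)
    (hemb : Topology.IsInducing e) (hinj : ∀ x, Function.Injective (mfderiv (𝓡 n) (𝓡 N) e x))
    {r : Euc N → M} (hr : ∀ y x, ‖e (r y) - y‖ ≤ ‖e x - y‖) (x₀ : M) :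
    ∀ᶠ y in 𝓝 (e x₀), ContMDiffAt (𝓡 N) (𝓡 n) ∞ r y := by
  let φ := extChartAt (𝓡 n) x₀
  let h : Euc n → Euc N := fun u => e (φ.symm u)
  have hhat : ∀ u ∈ φ.target, ContDiffAt ℝ ∞ h u := fun u hu => by
    rw [← contMDiffAt_iff_contDiffAt]
    exact he.contMDiffAt.comp u (contMDiffAt_symm hu)
  have hh : ContDiffOn ℝ ∞ h φ.target := fun u hu => (hhat u hu).contDiffWithinAt
  have hT : IsOpen φ.target := isOpen_extChartAt_target x₀
  have hu₀ : φ x₀ ∈ φ.target := mem_extChartAt_target x₀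
  have hx₀ : φ.symm (φ x₀) = x₀ := extChartAt_to_inv x₀
  have hhu₀ : h (φ x₀) = e x₀ := congrArg e hx₀
  have hd : Function.Injective (fderiv ℝ h (φ x₀)) := by
    have h1 : HasMFDerivAt (𝓡 n) (𝓡 N) (e ∘ φ.symm) (φ x₀)
        ((mfderiv (𝓡 n) (𝓡 N) e (φ.symm (φ x₀))).comp
          (mfderiv (𝓡 n) (𝓡 n) φ.symm (φ x₀))) :=
      HasMFDerivAt.comp _ (he.mdifferentiable (by simp) _).hasMFDerivAt
        ((contMDiffAt_symm hu₀).mdifferentiableAt (by simp)).hasMFDerivAt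
    have h2 := h1.mfderiv
    rw [mfderiv_eq_fderiv] at h2
    have h3 : fderiv ℝ h (φ x₀) = (mfderiv (𝓡 n) (𝓡 N) e (φ.symm (φ x₀))).comp
          (mfderiv (𝓡 n) (𝓡 n) φ.symm (φ x₀)) := h2
    rw [h3]
    exact (hinj _).comp (injective_mfderiv_extChartAt_symm hu₀)
  obtain ⟨ρ, hρ⟩ := exists_smooth_criticalPoint hT hh hu₀ hd
  -- The nearest-point map is continuous at the points of `e(M)`.
  have hrc : Tendsto r (𝓝 (e x₀)) (𝓝 x₀) := by
    rw [hemb.nhds_eq_comap, tendsto_comap_iff]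
    have hlim : Tendsto (fun y => 2 * ‖y - e x₀‖) (𝓝 (e x₀)) (𝓝 0) := by
      have : Continuous fun y => 2 * ‖y - e x₀‖ := by fun_prop
      simpa using this.tendsto (e x₀)
    refine tendsto_iff_norm_sub_tendsto_zero.2 (squeeze_zero (fun _ => norm_nonneg _)
      (fun y => ?_) hlim)
    have h1 : ‖e (r y) - y‖ ≤ ‖y - e x₀‖ := (hr y x₀).trans_eq (norm_sub_rev _ _)
    calc ‖e (r y) - e x₀‖ ≤ ‖e (r y) - y‖ + ‖y - e x₀‖ := norm_sub_le_norm_sub_add_norm_sub _ _ _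
      _ ≤ 2 * ‖y - e x₀‖ := by linarith
  have hφ : ContinuousAt φ x₀ := continuousAt_extChartAt x₀
  have hpair : Tendsto (fun y => (φ (r y), y)) (𝓝 (e x₀)) (𝓝 (φ x₀, h (φ x₀))) := by
    rw [hhu₀]
    exact (hφ.tendsto.comp hrc).prodMk_nhds tendsto_id
  have hsrc : ∀ᶠ y in 𝓝 (e x₀), r y ∈ φ.source := hrc (extChartAt_source_mem_nhds x₀)
  have hcrit : ∀ y, r y ∈ φ.source →
      ∀ v, ⟪h (φ (r y)) - y, fderiv ℝ h (φ (r y)) v⟫ = 0 := by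
    intro y hy v
    have hu : φ (r y) ∈ φ.target := φ.map_source hy
    have hmin : IsLocalMin (fun u => ⟪h u - y, h u - y⟫) (φ (r y)) := by
      refine Eventually.of_forall fun u => ?_
      simp only [real_inner_self_eq_norm_sq]
      have h1 : h (φ (r y)) = e (r y) := congrArg e (φ.left_inv hy)
      rw [h1]
      exact pow_le_pow_left₀ (norm_nonneg _) (hr y _) 2
    have hdh : HasFDerivAt (fun u => h u - y) (fderiv ℝ h (φ (r y))) (φ (r y)) :=
      ((hhat _ hu).differentiableAt (by simp)).hasFDerivAt.sub_const y
    have h2 := DFunLike.congr_fun (hmin.hasFDerivAt_eq_zero (hdh.inner ℝ hdh)) v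
    have h3 : ⟪h (φ (r y)) - y, fderiv ℝ h (φ (r y)) v⟫ +
        ⟪fderiv ℝ h (φ (r y)) v, h (φ (r y)) - y⟫ = 0 := h2
    rw [real_inner_comm (h (φ (r y)) - y)] at h3
    linarith
  have hev : ∀ᶠ y in 𝓝 (e x₀), r y ∈ φ.source ∧ ρ y = φ (r y) ∧ ContDiffAt ℝ ∞ ρ y := by
    filter_upwards [hpair.eventually hρ, hsrc] with y h1 h2
    exact ⟨h2, h1 (hcrit y h2)⟩
  filter_upwards [hev.eventually_nhds] with y hy
  obtain ⟨h1, h2, h3⟩ := hy.self_of_nhds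
  have h4 : r =ᶠ[𝓝 y] fun z => φ.symm (ρ z) := by
    filter_upwards [hy] with z hz
    rw [hz.2.1, φ.left_inv hz.1]
  refine ContMDiffAt.congr_of_eventuallyEq ?_ h4
  have h5 : ρ y ∈ φ.target := by rw [h2]; exact φ.map_source h1
  exact ContMDiffAt.comp (g := φ.symm) y (contMDiffAt_symm h5) h3.contMDiffAt

/-- A compact manifold is a smooth retract of an open subset of a Euclidean space. -/
theorem exists_smooth_retraction [T2Space M] [CompactSpace M] [Nonempty M] :
    ∃ (N : ℕ) (e : M → Euc N) (U : Opens (Euc N)) (r : Euc N → M),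
      ContMDiff (𝓡 n) (𝓡 N) ∞ e ∧ (∀ x, e x ∈ U) ∧ (∀ x, r (e x) = x) ∧
        ∀ y ∈ U, ContMDiffAt (𝓡 N) (𝓡 n) ∞ r y := by
  obtain ⟨N, e, he, hemb, hinj⟩ := exists_embedding_euclidean_of_compact (I := 𝓡 n) (M := M)
  have hmin : ∀ y : Euc N, ∃ x₀ : M, ∀ x, ‖e x₀ - y‖ ≤ ‖e x - y‖ := fun y => by
    have hc : Continuous fun x => ‖e x - y‖ := (hemb.continuous.sub continuous_const).norm
    obtain ⟨x₀, -, h⟩ := isCompact_univ.exists_isMinOn (univ_nonempty (α := M)) hc.continuousOn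
    exact ⟨x₀, fun x => h (mem_univ x)⟩
  choose r hr using hmin
  have hre : ∀ x, r (e x) = x := fun x => by
    have h := hr (e x) x
    rw [sub_self, norm_zero] at h
    exact hemb.injective (sub_eq_zero.1 (norm_le_zero_iff.1 h))
  refine ⟨N, e, ⟨interior {y | ContMDiffAt (𝓡 N) (𝓡 n) ∞ r y}, isOpen_interior⟩, r, he,
    fun x => ?_, hre, fun y hy => interior_subset (s := {y | ContMDiffAt (𝓡 N) (𝓡 n) ∞ r y}) hy⟩
  exact mem_interior_iff_mem_nhds.2
    (eventually_contMDiffAt_nearestPoint he hemb.isInducing hinj hr x)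

end ManifoldRetraction

/-! ### Comparison of forms on the manifold with forms on open subsets of Euclidean space -/

section Comparison

open TopologicalSpace (Opens)

variable {n N q : ℕ} {M : Type*} [TopologicalSpace M] [ChartedSpace (Euc n) M]
  [IsManifold (𝓡 n) ∞ M]

/-- The pullback `r^*α` of a form on `M` along a map `r` from a Euclidean space to `M`. -/
noncomputable def pullbackToEuc (r : Euc N → M) (α : RoughForm n M q) : EucForm N q :=
  roughPullback (n := N) r α

/-- The pullback `e^*w` of a form on a Euclidean space along a map `e` from `M`. -/
noncomputable def pullbackFromEuc (e : M → Euc N) (w : EucForm N q) : RoughForm n M q :=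
  roughPullback (m := N) (N := Euc N) e w

/-- The form `r^*α` in terms of the expression of `α` in a chart. -/
theorem pullbackToEuc_eq {r : Euc N → M} {y : Euc N} (hr : ContMDiffAt (𝓡 N) (𝓡 n) ∞ r y)
    (α : RoughForm n M q) {z₀ : M} (hz : r y ∈ (extChartAt (𝓡 n) z₀).source) :
    pullbackToEuc r α y = (coordRep α z₀ (extChartAt (𝓡 n) z₀ (r y))).compContinuousLinearMap
      (fderiv ℝ (fun y => extChartAt (𝓡 n) z₀ (r y)) y) := by
  let w : M → Euc n [⋀^Fin q]→L[ℝ] ℝ := α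
  let φ := extChartAt (𝓡 n) z₀
  have hφr : ContMDiffAt (𝓡 N) (𝓡 n) ∞ (fun y => φ (r y)) y :=
    ContMDiffAt.comp (g := φ) y (contMDiffAt_chart hz) hr
  have d1 : HasMFDerivAt (𝓡 N) (𝓡 n) (φ.symm ∘ fun y => φ (r y)) y
      ((mfderiv (𝓡 n) (𝓡 n) φ.symm (φ (r y))).comp (fderiv ℝ (fun y => φ (r y)) y)) :=
    HasMFDerivAt.comp y
      ((contMDiffAt_symm (φ.map_source hz)).mdifferentiableAt (by simp)).hasMFDerivAt
      ((contMDiffAt_iff_contDiffAt.1 hφr).differentiableAt (by simp)).hasFDerivAt.hasMFDerivAt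
  have heq : (φ.symm ∘ fun y => φ (r y)) =ᶠ[𝓝 y] r := by
    filter_upwards [hr.continuousAt ((isOpen_extChartAt_source z₀).mem_nhds hz)] with y' hy'
    exact φ.left_inv hy'
  have key := hasMFDerivAt_unique d1
    ((hr.mdifferentiableAt (by simp)).hasMFDerivAt.congr_of_eventuallyEq heq)
  let A : Euc N →L[ℝ] Euc n := mfderiv (𝓡 N) (𝓡 n) r y
  let B : Euc N →L[ℝ] Euc n :=
    (mfderiv (𝓡 n) (𝓡 n) φ.symm (φ (r y))).comp (fderiv ℝ (fun y => φ (r y)) y)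
  have hBA : B = A := key
  change (w (r y)).compContinuousLinearMap A =
    (w (φ.symm (φ (r y)))).compContinuousLinearMap B
  rw [hBA, φ.left_inv hz]

/-- The pullback of a closed form along a map that is smooth on `U` is smooth and closed on `U`. -/
theorem pullbackToEuc_mem_closedOn {r : Euc N → M} {U : Opens (Euc N)}
    (hr : ∀ y ∈ U, ContMDiffAt (𝓡 N) (𝓡 n) ∞ r y) {α : Form n M q} (hα : α ∈ closedForms n M q) :
    pullbackToEuc r α.1 ∈ closedOn U q := by
  have key : ∀ y ∈ U, ContDiffAt ℝ ∞ (pullbackToEuc r α.1) y ∧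
      extDeriv (pullbackToEuc r α.1) y = 0 := by
    intro y hy
    let φ := extChartAt (𝓡 n) (r y)
    have hrcont : ContinuousOn r U := fun y hy => (hr y hy).continuousAt.continuousWithinAt
    let O : Set (Euc N) := U ∩ r ⁻¹' φ.source
    have hO : IsOpen O := hrcont.isOpen_inter_preimage U.isOpen (isOpen_extChartAt_source (r y))
    have hyO : y ∈ O := ⟨hy, mem_extChartAt_source (r y)⟩
    have hF : ContDiffOn ℝ ∞ (fun y => φ (r y)) O := fun z hz => by
      refine ContDiffAt.contDiffWithinAt ?_
      rw [← contMDiffAt_iff_contDiffAt]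
      exact ContMDiffAt.comp (g := φ) z (contMDiffAt_chart hz.2) (hr z hz.1)
    have heq : EqOn (pullbackToEuc r α.1) (fun z =>
        (coordRep α.1 (r y) (φ (r z))).compContinuousLinearMap
          (fderiv ℝ (fun y => φ (r y)) z)) O := fun z hz =>
      pullbackToEuc_eq (hr z hz.1) α.1 hz.2
    have heq' := heq.eventuallyEq_of_mem (hO.mem_nhds hyO)
    have hφ : ∀ z ∈ O, φ (r z) ∈ φ.target := fun z hz => φ.map_source hz.2
    constructor
    · have h1 : ContDiffOn ℝ ∞ (fun z => coordRep α.1 (r y) (φ (r z))) O :=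
        (α.2 (r y)).comp hF hφ
      have h2 := contDiffOn_compContinuousLinearMap h1 (hF.fderiv_of_isOpen hO (by simp))
      exact (h2.contDiffAt (hO.mem_nhds hyO)).congr_of_eventuallyEq heq'
    · rw [heq'.extDeriv_eq, extDeriv_pullback (f := fun z => φ (r z))
        ((IsSmoothForm.contDiffAt α.2 (hφ y hyO)).differentiableAt (by simp))
        (hF.contDiffAt (hO.mem_nhds hyO)) minSmoothness_two_le,
        ← coordRep_roughExtDeriv α.2 (hφ y hyO)]
      have h0 : roughExtDeriv α.1 = 0 := congrArg Subtype.val hα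
      rw [h0]
      rfl
  exact ⟨fun y hy => (key y hy).1.contDiffWithinAt, fun y hy => (key y hy).2⟩

section FromEuc

variable {e : M → Euc N} (he : ContMDiff (𝓡 n) (𝓡 N) ∞ e)
include he

theorem contDiffAt_comp_extChartAt_symm {x₀ : M} {y : Euc n}
    (hy : y ∈ (extChartAt (𝓡 n) x₀).target) :
    ContDiffAt ℝ ∞ (fun u => e ((extChartAt (𝓡 n) x₀).symm u)) y := by
  rw [← contMDiffAt_iff_contDiffAt]
  exact he.contMDiffAt.comp y (contMDiffAt_symm hy)

/-- The form `e^*w` in a chart. -/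
theorem coordRep_pullbackFromEuc (w : EucForm N q) {x₀ : M} {y : Euc n}
    (hy : y ∈ (extChartAt (𝓡 n) x₀).target) :
    coordRep (pullbackFromEuc e w) x₀ y =
      (w (e ((extChartAt (𝓡 n) x₀).symm y))).compContinuousLinearMap
        (fderiv ℝ (fun u => e ((extChartAt (𝓡 n) x₀).symm u)) y) := by
  have h1 : HasMFDerivAt (𝓡 n) (𝓡 N) (e ∘ (extChartAt (𝓡 n) x₀).symm) y
      ((mfderiv (𝓡 n) (𝓡 N) e ((extChartAt (𝓡 n) x₀).symm y)).comp
        (mfderiv (𝓡 n) (𝓡 n) (extChartAt (𝓡 n) x₀).symm y)) :=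
    HasMFDerivAt.comp _ (he.mdifferentiable (by simp) _).hasMFDerivAt
      ((contMDiffAt_symm hy).mdifferentiableAt (by simp)).hasMFDerivAt
  have h2 := h1.mfderiv
  rw [mfderiv_eq_fderiv] at h2
  have h3 : fderiv ℝ (fun u => e ((extChartAt (𝓡 n) x₀).symm u)) y =
      (mfderiv (𝓡 n) (𝓡 N) e ((extChartAt (𝓡 n) x₀).symm y)).comp
        (mfderiv (𝓡 n) (𝓡 n) (extChartAt (𝓡 n) x₀).symm y) := h2
  rw [h3]
  rfl

theorem isSmoothForm_pullbackFromEuc {V : Opens (Euc N)} (heV : ∀ x, e x ∈ V)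
    {w : EucForm N q} (hw : ContDiffOn ℝ ∞ w V) :
    IsSmoothForm (pullbackFromEuc (n := n) e w) := by
  intro x₀
  have hh : ContDiffOn ℝ ∞ (fun u => e ((extChartAt (𝓡 n) x₀).symm u))
      (extChartAt (𝓡 n) x₀).target := fun u hu =>
    (contDiffAt_comp_extChartAt_symm he hu).contDiffWithinAt
  refine (contDiffOn_compContinuousLinearMap (hw.comp hh fun u _ => heV _)
    (hh.fderiv_of_isOpen (isOpen_extChartAt_target x₀) (by simp))).congr fun y hy => ?_
  exact coordRep_pullbackFromEuc he w hy

theorem roughExtDeriv_pullbackFromEuc {V : Opens (Euc N)} (heV : ∀ x, e x ∈ V)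
    {w : EucForm N q} (hw : ContDiffOn ℝ ∞ w V) :
    roughExtDeriv (pullbackFromEuc (n := n) e w) = pullbackFromEuc e (extDeriv w) := by
  funext x
  let φ := extChartAt (𝓡 n) x
  let h : Euc n → Euc N := fun u => e (φ.symm u)
  have hφx : φ x ∈ φ.target := mem_extChartAt_target x
  have hx : φ.symm (φ x) = x := extChartAt_to_inv x
  have hh : ContDiffAt ℝ ∞ h (φ x) := contDiffAt_comp_extChartAt_symm he hφx
  have heq : coordRep (pullbackFromEuc e w) x =ᶠ[𝓝 (φ x)] fun u =>
      (w (h u)).compContinuousLinearMap (fderiv ℝ h u) := by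
    filter_upwards [(isOpen_extChartAt_target x).mem_nhds hφx] with u hu
    exact coordRep_pullbackFromEuc he w hu
  have h1 : extDeriv (coordRep (pullbackFromEuc e w) x) (φ x) =
      (extDeriv w (h (φ x))).compContinuousLinearMap (fderiv ℝ h (φ x)) := by
    rw [heq.extDeriv_eq]
    exact extDeriv_pullback (differentiableAt_of_contDiffOn hw (heV _)) hh minSmoothness_two_le
  have d1 : HasMFDerivAt (𝓡 n) (𝓡 N) (h ∘ φ) x
      ((fderiv ℝ h (φ x)).comp (mfderiv (𝓡 n) (𝓡 n) φ x)) :=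
    HasMFDerivAt.comp x (hh.differentiableAt (by simp)).hasFDerivAt.hasMFDerivAt
      ((contMDiffAt_chart (mem_extChartAt_source x)).mdifferentiableAt (by simp)).hasMFDerivAt
  have heq' : h ∘ φ =ᶠ[𝓝 x] e := by
    filter_upwards [extChartAt_source_mem_nhds (I := 𝓡 n) x] with x' hx'
    exact congrArg e (φ.left_inv hx')
  have key := hasMFDerivAt_unique d1
    ((he.mdifferentiable (by simp) x).hasMFDerivAt.congr_of_eventuallyEq heq')
  let A : Euc n →L[ℝ] Euc N := (fderiv ℝ h (φ x)).comp (mfderiv (𝓡 n) (𝓡 n) φ x)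
  let B : Euc n →L[ℝ] Euc N := mfderiv (𝓡 n) (𝓡 N) e x
  have hAB : A = B := key
  have hhx : h (φ x) = e x := congrArg e hx
  unfold roughExtDeriv
  rw [h1, hhx]
  change (extDeriv w (e x)).compContinuousLinearMap A =
    (extDeriv w (e x)).compContinuousLinearMap B
  rw [hAB]

theorem mem_exactForms_of_pullbackFromEuc {V : Opens (Euc N)} (heV : ∀ x, e x ∈ V)
    {w : EucForm N q} (hw : w ∈ exactOn V q) {α : Form n M q}
    (hα : α.1 = pullbackFromEuc e w) : α ∈ exactForms n M q := by
  cases q with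
  | zero =>
    have h0 : α = 0 := by
      apply Subtype.ext
      rw [hα]
      funext x
      change (w (e x)).compContinuousLinearMap _ = 0
      rw [hw _ (heV x)]
      rfl
    rw [h0]
    exact Submodule.zero_mem _
  | succ q =>
    obtain ⟨η, hη, hηw⟩ := hw
    refine ⟨⟨pullbackFromEuc e η, isSmoothForm_pullbackFromEuc he heV hη⟩, Subtype.ext ?_⟩
    change roughExtDeriv (pullbackFromEuc e η) = α.1
    rw [roughExtDeriv_pullbackFromEuc he heV hη, hα]
    funext x
    change (extDeriv η (e x)).compContinuousLinearMap _ = (w (e x)).compContinuousLinearMap _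
    rw [hηw _ (heV x)]

end FromEuc

/-- Functoriality: `k^* r^* α = (r ∘ k)^* α`. -/
theorem pullbackFromEuc_pullbackToEuc {k : M → Euc N} (hk : ContMDiff (𝓡 n) (𝓡 N) ∞ k)
    {r : Euc N → M} {U : Opens (Euc N)} (hr : ∀ y ∈ U, ContMDiffAt (𝓡 N) (𝓡 n) ∞ r y)
    (hkU : ∀ x, k x ∈ U) (α : RoughForm n M q) :
    pullbackFromEuc k (pullbackToEuc r α) = roughPullback (n := n) (m := n) (r ∘ k) α := by
  funext x
  have h := mfderiv_comp x ((hr _ (hkU x)).mdifferentiableAt (by simp))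
    (hk.mdifferentiable (by simp) x)
  unfold roughPullback
  rw [h]
  rfl

/-- Functoriality: `e^* Φ^* w = (Φ ∘ e)^* w`. -/
theorem pullbackFromEuc_eucPullback {e : M → Euc N} (he : ContMDiff (𝓡 n) (𝓡 N) ∞ e)
    {Φ : Euc N → Euc N} {U : Opens (Euc N)} (hΦ : ContDiffOn ℝ ∞ Φ U) (heU : ∀ x, e x ∈ U)
    (w : EucForm N q) :
    pullbackFromEuc (n := n) e (eucPullback Φ w) = pullbackFromEuc (Φ ∘ e) w := by
  funext x
  have hd : DifferentiableAt ℝ Φ (e x) :=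
    (hΦ.contDiffAt (U.isOpen.mem_nhds (heU x))).differentiableAt (by simp)
  have h := (hd.hasFDerivAt.hasMFDerivAt.comp x (he.mdifferentiable (by simp) x).hasMFDerivAt).mfderiv
  unfold pullbackFromEuc roughPullback
  rw [h]
  rfl

/-! ### Finite-dimensionality and homotopy invariance -/

/-- A compact set has, within a given open neighbourhood, an open neighbourhood with
finite-dimensional cohomology: a finite union of balls. -/
theorem exists_hasFiniteCohomology_between {K : Set (Euc N)} (hK : IsCompact K)
    {U : Opens (Euc N)} (hKU : K ⊆ U) :
    ∃ V : Opens (Euc N), V ≤ U ∧ K ⊆ V ∧ HasFiniteCohomology V := by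
  have hball : ∀ y : Euc N, ∃ ε : ℝ, y ∈ K → 0 < ε ∧ Metric.ball y ε ⊆ U := fun y => by
    by_cases hy : y ∈ K
    · obtain ⟨ε, hε, h⟩ := Metric.isOpen_iff.1 U.isOpen y (hKU hy)
      exact ⟨ε, fun _ => ⟨hε, h⟩⟩
    · exact ⟨0, fun h => (hy h).elim⟩
  choose ε hε using hball
  obtain ⟨s, hsK, hs⟩ := hK.elim_nhds_subcover (fun y => Metric.ball y (ε y))
    fun y hy => Metric.ball_mem_nhds y (hε y hy).1
  let c : Euc N → Opens (Euc N) := fun y => ⟨Metric.ball y (ε y), Metric.isOpen_ball⟩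
  refine ⟨s.sup c, Finset.sup_le fun y hy => (hε y (hsK y hy)).2, fun y hy => ?_,
    hasFiniteCohomology_biUnion s c fun y => convex_ball y (ε y)⟩
  obtain ⟨z, hz, hyz⟩ := mem_iUnion₂.1 (hs hy)
  exact (Finset.le_sup hz : c z ≤ s.sup c) hyz

variable (n M) in
/-- The de Rham cohomology of a compact manifold is finite-dimensional: for a smooth retraction
`r` onto `M` of a neighbourhood with finite-dimensional cohomology, `r^*` is injective on
cohomology. -/
theorem finiteDimensional_cohomology [T2Space M] [CompactSpace M] (q : ℕ) :
    FiniteDimensional ℝ (Cohomology n M q) := by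
  rcases isEmpty_or_nonempty M with hM | hM
  · have hsub : Subsingleton (closedForms n M q) :=
      ⟨fun α β => Subtype.ext (Subtype.ext (funext fun x => (hM.false x).elim))⟩
    infer_instance
  obtain ⟨N, e, U, r, he, heU, hre, hr⟩ := exists_smooth_retraction (n := n) (M := M)
  obtain ⟨V, hVU, heV, hV⟩ := exists_hasFiniteCohomology_between
    (isCompact_range he.continuous) (range_subset_iff.2 heU)
  let L : closedForms n M q →ₗ[ℝ] EucForm N q :=
    { toFun := fun α => pullbackToEuc r α.1.1
      map_add' := fun _ _ => rfl
      map_smul' := fun _ _ => rfl }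
  have hL : (⊤ : Submodule ℝ (closedForms n M q)).map L ≤ closedOn V q := by
    rintro _ ⟨α, -, rfl⟩
    exact closedOn_mono hVU (pullbackToEuc_mem_closedOn hr α.2)
  have hre' : r ∘ e = id := funext hre
  have hinj : ⊤ ⊓ (exactOn V q).comap L ≤
      (exactForms n M q).submoduleOf (closedForms n M q) := by
    rintro α ⟨-, hα⟩
    refine mem_exactForms_of_pullbackFromEuc he (fun x => heV ⟨x, rfl⟩) hα ?_
    change α.1.1 = pullbackFromEuc e (pullbackToEuc r α.1.1)
    rw [pullbackFromEuc_pullbackToEuc he hr heU, hre', roughPullback_id]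
  obtain ⟨F, hF, hFtop⟩ := (FinMod.inf_comap L ((hV q).mono le_rfl hL)).mono hinj le_rfl
  refine Module.finite_def.2 ?_
  have hmap : F.map ((exactForms n M q).submoduleOf (closedForms n M q)).mkQ = ⊤ := by
    rw [eq_top_iff]
    rintro x -
    obtain ⟨α, rfl⟩ := Submodule.mkQ_surjective _ x
    obtain ⟨a, ha, b, hb, rfl⟩ := Submodule.mem_sup.1 (hFtop (Submodule.mem_top (x := α)))
    refine ⟨a, ha, ?_⟩
    rw [map_add, Submodule.mkQ_apply _ b, (Submodule.Quotient.mk_eq_zero _).2 hb, add_zero]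
  rw [← hmap]
  exact hF.map _

/-- Maps into a smooth retract `M` of `U ⊆ ℝᴺ` induce the same map on cohomology if they are
joined by a straight-line homotopy in `U`. -/
theorem cohomologyMap_eq_of_segment {e : M → Euc N} {U : Opens (Euc N)} {r : Euc N → M}
    (he : ContMDiff (𝓡 n) (𝓡 N) ∞ e) (heU : ∀ x, e x ∈ U) (hre : ∀ x, r (e x) = x)
    (hr : ∀ y ∈ U, ContMDiffAt (𝓡 N) (𝓡 n) ∞ r y) (f g : C^∞⟮𝓡 n, M; 𝓡 n, M⟯)
    (hfg : ∀ x, ∀ s ∈ Icc (0 : ℝ) 1, e (f x) + s • (e (g x) - e (f x)) ∈ U) (q : ℕ) :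
    cohomologyMap f q = cohomologyMap g q := by
  -- The extension `e ∘ f ∘ r` of a self-map `f` of `M` to `U`.
  have hsmooth : ∀ f : C^∞⟮𝓡 n, M; 𝓡 n, M⟯, ContDiffOn ℝ ∞ (fun y => e (f (r y))) U :=
    fun f y hy => by
      refine ContDiffAt.contDiffWithinAt ?_
      rw [← contMDiffAt_iff_contDiffAt]
      exact (he.comp f.contMDiff).contMDiffAt.comp y (hr y hy)
  have hpull : ∀ (f : C^∞⟮𝓡 n, M; 𝓡 n, M⟯) (α : RoughForm n M q),
      pullbackFromEuc e (eucPullback (fun y => e (f (r y))) (pullbackToEuc r α)) =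
        roughPullback f α := fun f α => by
    have h1 : (fun y => e (f (r y))) ∘ e = e ∘ f := by
      funext x
      simp only [Function.comp_apply, hre]
    have h2 : r ∘ (e ∘ f) = f := by
      funext x
      simp only [Function.comp_apply, hre]
    rw [pullbackFromEuc_eucPullback he (hsmooth f) heU, h1,
      pullbackFromEuc_pullbackToEuc (he.comp f.contMDiff) hr (fun x => heU _), h2]
  refine Submodule.linearMap_qext _ (LinearMap.ext fun α => ?_)
  refine (Submodule.Quotient.eq _).2 ?_
  have hexact := eucPullback_sub_mem_exactOn (hsmooth g) (hsmooth f) (U := U)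
    (fun y hy s hs => ?_) (pullbackToEuc_mem_closedOn hr α.2)
  · refine mem_exactForms_of_pullbackFromEuc he heU hexact ?_
    change roughPullback f α.1.1 - roughPullback g α.1.1 = _
    rw [← hpull f, ← hpull g]
    rfl
  · have h := hfg (r y) (1 - s) ⟨by linarith [hs.2], by linarith [hs.1]⟩
    convert h using 1
    module

/-- A continuous family of smooth maps, parametrized by a connected space, induces a constant
family of maps on cohomology. -/
theorem cohomologyMap_eq_of_continuous [T2Space M] [CompactSpace M] {T : Type*}
    [TopologicalSpace T] [PreconnectedSpace T] {f : T → C^∞⟮𝓡 n, M; 𝓡 n, M⟯}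
    (hf : Continuous fun p : T × M => f p.1 p.2) (s t : T) (q : ℕ) :
    cohomologyMap (f s) q = cohomologyMap (f t) q := by
  rcases isEmpty_or_nonempty M with hM | hM
  · have hst : f s = f t := ContMDiffMap.ext fun x => (hM.false x).elim
    rw [hst]
  obtain ⟨N, e, U, r, he, heU, hre, hr⟩ := exists_smooth_retraction (n := n) (M := M)
  obtain ⟨δ, hδ, hδU⟩ := (isCompact_range he.continuous).exists_thickening_subset_open U.isOpen
    (range_subset_iff.2 heU)
  refine IsLocallyConstant.apply_eq_of_preconnectedSpace (f := fun t => cohomologyMap (f t) q)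
    ((IsLocallyConstant.iff_eventually_eq _).2 fun t₀ => ?_) s t
  have hclose : ∀ᶠ t in 𝓝 t₀, ∀ x ∈ (univ : Set M), dist (e (f t x)) (e (f t₀ x)) < δ := by
    refine isCompact_univ.eventually_forall_of_forall_eventually fun x _ => ?_
    have hc : Continuous fun p : T × M => dist (e (f p.1 p.2)) (e (f t₀ p.2)) :=
      (he.continuous.comp hf).dist
        (he.continuous.comp ((f t₀).contMDiff.continuous.comp continuous_snd))
    refine hc.continuousAt.eventually (gt_mem_nhds ?_)
    simpa using hδ
  filter_upwards [hclose] with t ht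
  refine cohomologyMap_eq_of_segment he heU hre hr (f t) (f t₀) (fun x s hs => hδU ?_) q
  refine Metric.mem_thickening_iff.2 ⟨e (f t x), ⟨f t x, rfl⟩, ?_⟩
  rw [dist_eq_norm, add_sub_cancel_left, norm_smul, Real.norm_of_nonneg hs.1]
  have h := ht x (mem_univ x)
  rw [dist_comm, dist_eq_norm] at h
  exact (mul_le_of_le_one_left (norm_nonneg _) hs.2).trans_lt h

theorem cohomologyMap_eq_id {f : C^∞⟮𝓡 n, M; 𝓡 n, M⟯} (hf : ∀ x, f x = x) (q : ℕ) :
    cohomologyMap f q = LinearMap.id := by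
  have hid : (f : M → M) = id := funext hf
  refine Submodule.linearMap_qext _ (LinearMap.ext fun α => ?_)
  refine congrArg (Submodule.Quotient.mk) (Subtype.ext (Subtype.ext ?_))
  change roughPullback f α.1.1 = α.1.1
  rw [hid, roughPullback_id]

end Comparison

end DeRham

theorem mainTheorem4 (n : ℕ) (M : Type*) [TopologicalSpace M] [T2Space M] [CompactSpace M]
    [ChartedSpace (EuclideanSpace ℝ (Fin n)) M] [IsManifold (𝓡 n) ∞ M]
    (_g : DeRham.RiemannianMetric n M) (_orientation : DeRham.VolumeForm n M)
    (J : Set ℝ) (hJ : J.OrdConnected)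
    (f : J → C^∞⟮𝓡 n, M; 𝓡 n, M⟯)
    (hf : Continuous fun p : J × M => f p.1 p.2)
    (t₀ : J) (ht₀ : ∀ x : M, f t₀ x = x) :
    (∀ q : ℕ, FiniteDimensional ℝ (DeRham.Cohomology n M q)) ∧
      ∀ t : J, DeRham.lefschetzNumber (f t) = (DeRham.eulerNumber n M : ℝ) := by
  have hfin : ∀ q : ℕ, FiniteDimensional ℝ (DeRham.Cohomology n M q) := fun q =>
    DeRham.finiteDimensional_cohomology n M q
  refine ⟨hfin, fun t => ?_⟩
  have hJ' : PreconnectedSpace J := isPreconnected_iff_preconnectedSpace.1 hJ.isPreconnected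
  have hid : ∀ q, DeRham.cohomologyMap (f t) q = LinearMap.id := fun q =>
    (DeRham.cohomologyMap_eq_of_continuous hf t t₀ q).trans (DeRham.cohomologyMap_eq_id ht₀ q)
  simp only [DeRham.lefschetzNumber, DeRham.eulerNumber, DeRham.bettiNumber, hid,
    LinearMap.trace_id]
  push_cast
  rfl
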